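/- Let $r\ge 1$. For a matroid $M$ on a finite set $E$, a representation over a field $K$ is a map $\rho\colon E\to V$ to a $K$-vector space such that a subset of $E$ is independent iff $\rho$ maps it injectively onto a linearly independent set, and such that $\rho(E)$ spans $V$; $M$ is regular if it is representable over every field. Let $\mathcal R(r,\mathbb F_2)$ be the category of regular matroids $(E,M)$ of rank $r$ on finite sets, whose morphisms $(E_1,M_1)\to(E_2,M_2)$ are the injections $f\colon E_1\to E_2$ such that a subset of $E_1$ is independent iff its image in $E_2$ is. Let $\mathcal G\ell(r,\mathbb F_2)$ be the groupoid of $\mathbb F_2$-vector spaces isomorphic to $\mathbb F_2^r$ and linear isomorphisms. Let $H_1(M)$ be the abelian group generated by $E$ modulo $\sum_{e\in C}e=0$ for all circuits $C$ of $M$, and $H_1(M;\mathbb F_2)=H_1(M)\otimes\mathbb F_2$; this gives a functor $H_1(-;\mathbb F_2)\colon\mathcal R(r,\mathbb F_2)\to\mathcal G\ell(r,\mathbb F_2)$. Let $IR(r,\mathbb F_2)$ be the poset, ordered by inclusion, of all subsets of $\mathbb F_2^r\setminus\{0\}$ which, with their linear matroid structure, are regular matroids of rank $r$. Write $B\mathcal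 C$ for the classifying space of a category $\mathcal C$ (the geometric realization of its nerve), and $|P|=BP$ for a poset $P$. Let $Z$ be any object of $\mathcal G\ell(r,\mathbb F_2)$ (for example $\mathbb F_2^r$). The fiber category $\widetilde{\mathcal R}_Z$ of $H_1(-;\mathbb F_2)$ has as objects the pairs $(M,f)$ with $M$ in $\mathcal R(r,\mathbb F_2)$ and $f\colon Z\to H_1(M;\mathbb F_2)$ an isomorphism, and as morphisms $(M,f)\to(N,g)$ the morphisms $h\colon M\to N$ with $g=H_1(h;\mathbb F_2)\circ f$. Then: 1. $|IR(r,\mathbb F_2)|$ is homotopy equivalent to $B\widetilde{\mathcal R}_Z$. 2. The sequence $$|IR(r,\mathbb F_2)|\to B\mathcal R(r,\mathbb F_2)\to B\mathcal G\ell(r,\mathbb F_2),$$ whose maps are induced by the functor sending a set of vectors to its linear matroid and by $H_1(-;\mathbb F_2)$, is a homotopy fiber sequence over the vertex $Z$: there is a homotopy from the composite to the constant map at $Z$ such that the induced map from $|IR(r,\mathbb F_2)|$ to the homotopy fiber over $Z$ of the second map (the space of pairs of a point $x$ of $B\mathcal R(r,\mathbb F_2)$ and a path from the image of $x$ to $Z$)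 is a homotopy equivalence. -/

import Mathlib

open CategoryTheory

namespace RegMatroid

/-! ### Linear representations of matroids and regular matroids

A matroid on a finite set `E` is a Mathlib matroid on the type `E` whose ground set is `Set.univ`. -/

section Representations

variable {E : Type} {K : Type} [Field K] {V : Type} [AddCommGroup V] [Module K V]

/-- `ρ : E → V` represents `M`: a subset `I` of `E` is independent iff `ρ` is injective on `I` and
maps it onto a linearly independent set (this is `LinearIndepOn K ρ I`), and the image of `ρ`
spans `V`. -/
def IsRepresentation (K : Type) [Field K] {V : Type} [AddCommGroup V] [Module K V]
    (M : Matroid E) (ρ : E → V) : Prop :=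
  (∀ I : Set E, M.Indep I ↔ LinearIndepOn K ρ I) ∧ Submodule.span K (Set.range ρ) = ⊤

/-- `M` is representable over the field `K`. -/
def IsRepresentable (K : Type) [Field K] (M : Matroid E) : Prop :=
  ∃ (V : Type) (_ : AddCommGroup V) (_ : Module K V) (ρ : E → V), IsRepresentation K M ρ

/-- A matroid is regular if it is representable over every field. -/
def IsRegular (M : Matroid E) : Prop :=
  ∀ (K : Type) [Field K], IsRepresentable K M

theorem linearIndepOn_augment {ρ : E → V} {I J : Set E} (hI : LinearIndepOn K ρ I)
    (hJ : LinearIndepOn K ρ J) (hIJ : I.encard < J.encard) :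
    ∃ e ∈ J, e ∉ I ∧ LinearIndepOn K ρ (insert e I) := by
  by_contra! hcon
  have hsub : ∀ e ∈ J, ρ e ∈ Submodule.span K (ρ '' I) := by
    intro e he
    by_cases heI : e ∈ I
    · exact Submodule.subset_span ⟨e, heI, rfl⟩
    · by_contra hns
      exact hcon e he heI (hI.insert hns)
  have hfinI : I.Finite := Set.finite_of_encard_le_coe (k := I.encard.toNat) (by
    rw [ENat.natCast_toNat (ne_top_of_lt hIJ)])
  have h1 : (ρ '' J).encard ≤ (ρ '' I).encard := by
    have hle : Submodule.span K (ρ '' J) ≤ Submodule.span K (ρ '' I) := by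
      rw [Submodule.span_le]
      rintro _ ⟨e, he, rfl⟩
      exact hsub e he
    have hr := Submodule.rank_mono hle
    rw [rank_span_set hJ.id_image, rank_span_set hI.id_image] at hr
    exact Cardinal.toENat.monotone' hr
  rw [hJ.injOn.encard_image, hI.injOn.encard_image] at h1
  exact absurd hIJ (not_lt.mpr h1)

theorem linearIndepOn_comp_iff {E' : Type} {ρ : E → V} {j : E' → E} (hj : Function.Injective j)
    (I : Set E') : LinearIndepOn K (ρ ∘ j) I ↔ LinearIndepOn K ρ (j '' I) := by
  have h : Function.Injective (fun x : I => (⟨j x, x, x.2, rfl⟩ : (j '' I : Set E))) :=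
    fun x y hxy => Subtype.ext (hj (congrArg Subtype.val hxy))
  have h' : Function.Surjective (fun x : I => (⟨j x, x, x.2, rfl⟩ : (j '' I : Set E))) := by
    rintro ⟨_, x, hx, rfl⟩
    exact ⟨⟨x, hx⟩, rfl⟩
  exact linearIndependent_equiv (R := K) (Equiv.ofBijective _ ⟨h, h'⟩)
    (f := fun y : (j '' I : Set E) => ρ y)

/-- The linear matroid on `E` defined by a family `ρ : E → V` of vectors. -/
def linearMatroid (K : Type) [Field K] {V : Type} [AddCommGroup V] [Module K V] [Finite E]
    (ρ : E → V) : Matroid E :=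
  (IndepMatroid.ofFinite (E := Set.univ) Set.finite_univ (fun I => LinearIndepOn K ρ I)
    (linearIndepOn_empty K ρ)
    (fun _ _ hJ hIJ => hJ.mono hIJ)
    (fun I J hI hJ hIJ => linearIndepOn_augment hI hJ (by
      rwa [← (Set.toFinite I).cast_ncard_eq, ← (Set.toFinite J).cast_ncard_eq, Nat.cast_lt]))
    (fun I _ => Set.subset_univ I)).matroid

@[simp] theorem linearMatroid_ground [Finite E] (ρ : E → V) :
    (linearMatroid K ρ).E = Set.univ := rfl

@[simp] theorem linearMatroid_indep [Finite E] (ρ : E → V) (I : Set E) :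
    (linearMatroid K ρ).Indep I ↔ LinearIndepOn K ρ I := Iff.rfl

end Representations

/-! ### The category of regular matroids of rank `r` -/

/-- Objects of the category `R(r, 𝔽₂)`: a finite set `E` with a regular matroid of rank `r`. -/
structure RegularMatroid (r : ℕ) : Type 1 where
  E : Type
  finite : Finite E
  M : Matroid E
  ground : M.E = Set.univ
  rank : M.eRank = r
  regular : IsRegular M

attribute [instance] RegularMatroid.finite

namespace RegularMatroid

variable {r : ℕ}

/-- Morphisms: injective maps `f` such that a set is independent iff its image is. (All morphism
sets are placed in `Type 1`, so that every category below is a small category in `Type 1`.) -/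
@[ext]
structure Hom (A B : RegularMatroid r) : Type 1 where
  toFun : A.E → B.E
  injective : Function.Injective toFun
  indep_iff : ∀ I : Set A.E, A.M.Indep I ↔ B.M.Indep (toFun '' I)

instance : SmallCategory (RegularMatroid r) where
  Hom := Hom
  id A := ⟨id, Function.injective_id, fun I => by rw [Set.image_id]⟩
  comp f g := ⟨g.toFun ∘ f.toFun, g.injective.comp f.injective, fun I => by
    rw [f.indep_iff, g.indep_iff, Set.image_comp]⟩

@[simp] theorem id_toFun (A : RegularMatroid r) : (𝟙 A : Hom A A).toFun = id := rfl

@[simp] theorem comp_toFun {A B C : RegularMatroid r} (f : A ⟶ B) (g : B ⟶ C) :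
    (f ≫ g : Hom A C).toFun = g.toFun ∘ f.toFun := rfl

end RegularMatroid

/-! ### The groupoid `Gℓ(r, 𝔽₂)` -/

/-- Objects of the groupoid `Gℓ(r, 𝔽₂)`: vector spaces over `𝔽₂` isomorphic to `𝔽₂ʳ`. -/
structure GL2 (r : ℕ) : Type 1 where
  V : Type
  [addCommGroup : AddCommGroup V]
  [module : Module (ZMod 2) V]
  nonempty_equiv : Nonempty (V ≃ₗ[ZMod 2] (Fin r → ZMod 2))

attribute [instance] GL2.addCommGroup GL2.module

namespace GL2

variable {r : ℕ}

/-- Morphisms: linear isomorphisms. -/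
@[ext]
structure Hom (V W : GL2 r) : Type 1 where
  toEquiv : V.V ≃ₗ[ZMod 2] W.V

instance : Groupoid (GL2 r) where
  Hom := Hom
  id V := ⟨LinearEquiv.refl _ _⟩
  comp f g := ⟨f.toEquiv.trans g.toEquiv⟩
  inv f := ⟨f.toEquiv.symm⟩
  inv_comp f := Hom.ext (LinearEquiv.ext fun x => f.toEquiv.apply_symm_apply x)
  comp_inv f := Hom.ext (LinearEquiv.ext fun x => f.toEquiv.symm_apply_apply x)

end GL2

/-! ### First homology of a matroid -/

section Homology

open TensorProduct

variable {E : Type} {r : ℕ}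

/-- The subgroup of relations `∑ e ∈ C, e = 0`, for all circuits `C` of `M`. -/
noncomputable def circuitRelations (M : Matroid E) : Submodule ℤ (E →₀ ℤ) :=
  Submodule.span ℤ {x | ∃ C : Finset E, M.IsCircuit (C : Set E) ∧
    x = ∑ e ∈ C, Finsupp.single e 1}

/-- `H₁(M)`: the abelian group generated by `E` modulo `∑ e ∈ C, e = 0` for all circuits `C`. -/
noncomputable abbrev H1 (M : Matroid E) : Type := (E →₀ ℤ) ⧸ circuitRelations M

/-- `H₁(M; 𝔽₂) = 𝔽₂ ⊗ H₁(M)`, a vector space over `𝔽₂`. -/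
noncomputable abbrev H1F2 (M : Matroid E) : Type := ZMod 2 ⊗[ℤ] H1 M

/-- The class in `H₁(M)` of an element of `E`. -/
noncomputable def H1.of (M : Matroid E) (e : E) : H1 M := (circuitRelations M).mkQ (Finsupp.single e 1)

/-- The universal cocycle `E → H₁(M; 𝔽₂)`. -/
noncomputable def H1F2.of (M : Matroid E) (e : E) : H1F2 M := 1 ⊗ₜ H1.of M e

theorem H1.sum_circuit {M : Matroid E} {C : Finset E} (hC : M.IsCircuit (C : Set E)) :
    ∑ e ∈ C, H1.of M e = 0 := by
  simp only [H1.of]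
  rw [← map_sum, Submodule.mkQ_apply, Submodule.Quotient.mk_eq_zero]
  exact Submodule.subset_span ⟨C, hC, rfl⟩

theorem H1F2.sum_circuit {M : Matroid E} {C : Finset E} (hC : M.IsCircuit (C : Set E)) :
    ∑ e ∈ C, H1F2.of M e = 0 := by
  simp only [H1F2.of]
  rw [← TensorProduct.tmul_sum, H1.sum_circuit hC, TensorProduct.tmul_zero]

theorem H1F2.span_of (M : Matroid E) :
    Submodule.span (ZMod 2) (Set.range (H1F2.of M)) = ⊤ := by
  rw [eq_top_iff]
  rintro x -
  induction x using TensorProduct.induction_on with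
  | zero => exact Submodule.zero_mem _
  | add x y hx hy => exact Submodule.add_mem _ hx hy
  | tmul a y =>
    obtain ⟨f, rfl⟩ := (circuitRelations M).mkQ_surjective y
    have key : ∀ f : E →₀ ℤ, (1 : ZMod 2) ⊗ₜ[ℤ] (circuitRelations M).mkQ f ∈
        Submodule.span (ZMod 2) (Set.range (H1F2.of M)) := by
      intro f
      induction f using Finsupp.induction_linear with
      | zero => rw [map_zero, TensorProduct.tmul_zero]; exact Submodule.zero_mem _
      | add f g hf hg => rw [map_add, TensorProduct.tmul_add]; exact Submodule.add_mem _ hf hg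
      | single e n =>
        have : (Finsupp.single e n : E →₀ ℤ) = n • Finsupp.single e 1 := by simp
        rw [this, map_smul, TensorProduct.tmul_smul]
        have he : H1F2.of M e ∈ Submodule.span (ZMod 2) (Set.range (H1F2.of M)) :=
          Submodule.subset_span ⟨e, rfl⟩
        exact zsmul_mem he n
    have : a ⊗ₜ[ℤ] (circuitRelations M).mkQ f =
        a • ((1 : ZMod 2) ⊗ₜ[ℤ] (circuitRelations M).mkQ f) := by
      rw [TensorProduct.smul_tmul', smul_eq_mul, mul_one]
    rw [this]
    exact Submodule.smul_mem _ _ (key f)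

theorem H1F2.span_base [Finite E] {M : Matroid E} (hE : M.E = Set.univ) {B : Set E}
    (hB : M.IsBase B) :
    Submodule.span (ZMod 2) (H1F2.of M '' B) = ⊤ := by
  classical
  rw [eq_top_iff, ← H1F2.span_of M, Submodule.span_le]
  rintro _ ⟨e, rfl⟩
  by_cases he : e ∈ B
  · exact Submodule.subset_span ⟨e, he, rfl⟩
  have hC := hB.fundCircuit_isCircuit (x := e) (by rw [hE]; trivial) he
  set C : Finset E := (Set.toFinite (M.fundCircuit e B)).toFinset with hCdef
  have hCC : (C : Set E) = M.fundCircuit e B := by simp [hCdef]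
  have hsum := H1F2.sum_circuit (M := M) (C := C) (by rw [hCC]; exact hC)
  have heC : e ∈ C := by
    rw [← Finset.mem_coe, hCC]; exact M.mem_fundCircuit e B
  rw [← Finset.add_sum_erase C _ heC] at hsum
  rw [SetLike.mem_coe, eq_neg_of_add_eq_zero_left hsum]
  refine Submodule.neg_mem _ (Submodule.sum_mem _ fun x hx => Submodule.subset_span ⟨x, ?_, rfl⟩)
  rw [Finset.mem_erase] at hx
  have : x ∈ insert e B := M.fundCircuit_subset_insert e B (by
    rw [← hCC]; exact hx.2)
  exact this.resolve_left hx.1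

theorem sum_circuit_representation {V : Type} [AddCommGroup V] [Module (ZMod 2) V]
    {M : Matroid E} {ρ : E → V}
    (hρ : ∀ I : Set E, M.Indep I ↔ LinearIndepOn (ZMod 2) ρ I)
    {C : Finset E} (hC : M.IsCircuit (C : Set E)) : ∑ e ∈ C, ρ e = 0 := by
  classical
  have hdep : ¬ LinearIndepOn (ZMod 2) ρ (C : Set E) := fun h => hC.not_indep ((hρ _).2 h)
  rw [linearIndepOn_finset_iff] at hdep
  push Not at hdep
  obtain ⟨g, hg, i, hi, hgi⟩ := hdep
  set D : Finset E := C.filter (fun e => g e ≠ 0) with hD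
  have hDC : (D : Set E) ⊆ C := by
    intro x hx; exact (Finset.mem_filter.1 hx).1
  have hDsum : ∑ e ∈ D, g e • ρ e = 0 := by
    rw [hD, Finset.sum_filter_of_ne]
    · exact hg
    · intro x _ hx h0
      exact hx (by rw [h0, zero_smul])
  have hDdep : ¬ M.Indep (D : Set E) := by
    rw [hρ, linearIndepOn_finset_iff]
    push Not
    exact ⟨g, hDsum, i, Finset.mem_filter.2 ⟨hi, hgi⟩, hgi⟩
  have hDC' : D = C := by
    have := hC.eq_of_not_indep_subset hDdep hDC
    exact_mod_cast this
  have hone : ∀ e ∈ C, g e = 1 := by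
    intro e he
    rw [← hDC'] at he
    have h := (Finset.mem_filter.1 he).2
    generalize g e = a at h
    revert a
    decide
  rw [← hg]
  exact Finset.sum_congr rfl fun e he => by rw [hone e he, one_smul]

/-- The linear map `H₁(M; 𝔽₂) → V` induced by a function that vanishes on circuits. -/
noncomputable def H1F2.lift {V : Type} [AddCommGroup V] [Module (ZMod 2) V] (M : Matroid E)
    (ρ : E → V) (hρ : ∀ C : Finset E, M.IsCircuit (C : Set E) → ∑ e ∈ C, ρ e = 0) :
    H1F2 M →ₗ[ZMod 2] V :=
  TensorProduct.AlgebraTensorModule.lift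
    (LinearMap.toSpanSingleton (ZMod 2) (H1 M →ₗ[ℤ] V)
      ((circuitRelations M).liftQ (Finsupp.linearCombination ℤ ρ) (by
        rw [circuitRelations, Submodule.span_le]
        rintro _ ⟨C, hC, rfl⟩
        simp [hρ C hC])))

@[simp] theorem H1F2.lift_of {V : Type} [AddCommGroup V] [Module (ZMod 2) V] (M : Matroid E)
    (ρ : E → V) (hρ : ∀ C : Finset E, M.IsCircuit (C : Set E) → ∑ e ∈ C, ρ e = 0) (e : E) :
    H1F2.lift M ρ hρ (H1F2.of M e) = ρ e := by
  simp [H1F2.lift, H1F2.of, H1.of]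

theorem H1F2.linearIndepOn_base {M : Matroid E}
    (hM : IsRepresentable (ZMod 2) M) {B : Set E} (hB : M.IsBase B) :
    LinearIndepOn (ZMod 2) (H1F2.of M) B := by
  obtain ⟨V, _, _, ρ, hρ, -⟩ := hM
  have h := (hρ B).1 hB.indep
  refine LinearIndepOn.of_comp
    (H1F2.lift M ρ fun C hC => sum_circuit_representation hρ hC) ?_
  convert h using 1
  ext e
  simp

theorem H1F2.nonempty_equiv (A : RegularMatroid r) :
    Nonempty (H1F2 A.M ≃ₗ[ZMod 2] (Fin r → ZMod 2)) := by
  obtain ⟨B, hB⟩ := A.M.exists_isBase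
  have hli := H1F2.linearIndepOn_base (A.regular (ZMod 2)) hB
  have hsp := H1F2.span_base A.ground hB
  have hcard : Nat.card B = r := by
    have h := hB.encard_eq_eRank
    rw [A.rank, ← (Set.toFinite B).cast_ncard_eq] at h
    rw [Nat.card_coe_set_eq]
    exact_mod_cast h
  have b : Module.Basis B (ZMod 2) (H1F2 A.M) :=
    Module.Basis.mk hli (by
      rw [← hsp]
      apply Submodule.span_mono
      rintro _ ⟨e, he, rfl⟩
      exact ⟨⟨e, he⟩, rfl⟩)
  exact ⟨(b.reindex ((Finite.equivFin B).trans (finCongr hcard))).equivFun⟩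

theorem RegularMatroid.Hom.isCircuit_image {A B : RegularMatroid r} (f : A ⟶ B) {C : Set A.E}
    (hC : A.M.IsCircuit C) : B.M.IsCircuit (f.toFun '' C) := by
  rw [Matroid.isCircuit_iff_minimal_not_indep (by rw [B.ground]; exact Set.subset_univ _)]
  refine ⟨fun h => hC.not_indep ((f.indep_iff C).2 h), fun D hD hDC => ?_⟩
  obtain ⟨D', hD', rfl⟩ := Set.subset_image_iff.1 hDC
  have := hC.eq_of_not_indep_subset (fun h => hD ((f.indep_iff D').1 h)) hD'
  rw [this]

theorem RegularMatroid.Hom.isBase_image {A B : RegularMatroid r} (f : A ⟶ B) {I : Set A.E}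
    (hI : A.M.IsBase I) : B.M.IsBase (f.toFun '' I) := by
  have hind := (f.indep_iff I).1 hI.indep
  obtain ⟨J, hJ, hIJ⟩ := hind.exists_isBase_superset
  have h1 : (f.toFun '' I).encard = J.encard := by
    rw [f.injective.encard_image, hI.encard_eq_eRank, hJ.encard_eq_eRank, A.rank, B.rank]
  have heq : f.toFun '' I = J := (Set.toFinite _).eq_of_subset_of_encard_le hIJ h1.ge
  rw [heq]
  exact hJ

/-- The map induced on `H₁(-)` by a morphism of matroids: `[e] ↦ [f e]`. -/
noncomputable def H1.map {A B : RegularMatroid r} (f : A ⟶ B) : H1 A.M →ₗ[ℤ] H1 B.M :=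
  (circuitRelations A.M).mapQ (circuitRelations B.M) (Finsupp.lmapDomain ℤ ℤ f.toFun) (by
    classical
    rw [circuitRelations, Submodule.span_le]
    rintro _ ⟨C, hC, rfl⟩
    refine Submodule.subset_span ⟨C.image f.toFun, ?_, ?_⟩
    · rw [Finset.coe_image]; exact RegularMatroid.Hom.isCircuit_image f hC
    · rw [Finset.sum_image (fun _ _ _ _ h => f.injective h), map_sum]
      simp)

@[simp] theorem H1.map_of {A B : RegularMatroid r} (f : A ⟶ B) (e : A.E) :
    H1.map f (H1.of A.M e) = H1.of B.M (f.toFun e) := by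
  simp [H1.map, H1.of]

/-- The map induced on `H₁(-; 𝔽₂)` by a morphism of matroids. -/
noncomputable def H1F2.map {A B : RegularMatroid r} (f : A ⟶ B) :
    H1F2 A.M →ₗ[ZMod 2] H1F2 B.M :=
  (H1.map f).baseChange (ZMod 2)

@[simp] theorem H1F2.map_of {A B : RegularMatroid r} (f : A ⟶ B) (e : A.E) :
    H1F2.map f (H1F2.of A.M e) = H1F2.of B.M (f.toFun e) := by
  simp [H1F2.map, H1F2.of]

theorem H1F2.map_bijective {A B : RegularMatroid r} (f : A ⟶ B) :
    Function.Bijective (H1F2.map f) := by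
  obtain ⟨eA⟩ := H1F2.nonempty_equiv A
  obtain ⟨eB⟩ := H1F2.nonempty_equiv B
  have hsurj : Function.Surjective (H1F2.map f) := by
    obtain ⟨I, hI⟩ := A.M.exists_isBase
    rw [← LinearMap.range_eq_top, eq_top_iff,
      ← H1F2.span_base B.ground (RegularMatroid.Hom.isBase_image f hI), Submodule.span_le]
    rintro _ ⟨_, ⟨e, -, rfl⟩, rfl⟩
    exact ⟨H1F2.of A.M e, H1F2.map_of f e⟩
  have : Module.Finite (ZMod 2) (H1F2 A.M) := Module.Finite.equiv eA.symm
  have : Module.Finite (ZMod 2) (H1F2 B.M) := Module.Finite.equiv eB.symm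
  refine ⟨?_, hsurj⟩
  rwa [LinearMap.injective_iff_surjective_of_finrank_eq_finrank
    (eA.trans eB.symm).finrank_eq]

/-- The mod-2 homology functor `H₁(-; 𝔽₂) : R(r, 𝔽₂) ⥤ Gℓ(r, 𝔽₂)`. -/
noncomputable def homologyFunctor (r : ℕ) : RegularMatroid r ⥤ GL2 r where
  obj A := ⟨H1F2 A.M, H1F2.nonempty_equiv A⟩
  map f := ⟨LinearEquiv.ofBijective (H1F2.map f) (H1F2.map_bijective f)⟩
  map_id A := by
    refine GL2.Hom.ext (LinearEquiv.toLinearMap_injective ?_)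
    refine LinearMap.ext_on_range (H1F2.span_of A.M) fun e => ?_
    exact H1F2.map_of (𝟙 A) e
  map_comp {A B C} f g := by
    refine GL2.Hom.ext (LinearEquiv.toLinearMap_injective ?_)
    refine LinearMap.ext_on_range (H1F2.span_of A.M) fun e => ?_
    change H1F2.map (f ≫ g) (H1F2.of A.M e) = H1F2.map g (H1F2.map f (H1F2.of A.M e))
    rw [H1F2.map_of, H1F2.map_of, H1F2.map_of]
    rfl

end Homology

/-- The fiber category of `H₁(-; 𝔽₂)` over an object `Z` of the groupoid `Gℓ(r, 𝔽₂)`: objects are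
pairs `(A, f)` with `A` a regular matroid of rank `r` and `f : Z ⟶ H₁(A; 𝔽₂)` a (necessarily
invertible) morphism; a morphism `(A, f) ⟶ (B, g)` is a morphism `h : A ⟶ B` with
`f ≫ H₁(h; 𝔽₂) = g`. -/
abbrev FiberCategory (r : ℕ) (Z : GL2 r) : Type 1 := StructuredArrow Z (homologyFunctor r)

/-! ### The fiber poset -/

/-- The set `IR(r, 𝔽₂)` of subsets `S` of `𝔽₂ʳ \ 0` which, with the linear matroid structure, are
regular matroids of rank `r`. -/
@[ext]
structure IR (r : ℕ) : Type 1 where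
  carrier : Set (Fin r → ZMod 2)
  zero_notMem : 0 ∉ carrier
  rank : (linearMatroid (ZMod 2) (Subtype.val : carrier → Fin r → ZMod 2)).eRank = r
  regular : IsRegular (linearMatroid (ZMod 2) (Subtype.val : carrier → Fin r → ZMod 2))

namespace IR

variable {r : ℕ}

/-- `IR(r, 𝔽₂)` is ordered by inclusion. As every preorder, it is also regarded as a category. -/
instance : PartialOrder (IR r) := PartialOrder.lift IR.carrier (fun _ _ h => IR.ext h)

/-- An element of `IR(r, 𝔽₂)` as a regular matroid. -/
def toRegularMatroid (S : IR r) : RegularMatroid r where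
  E := S.carrier
  finite := inferInstance
  M := linearMatroid (ZMod 2) (Subtype.val : S.carrier → Fin r → ZMod 2)
  ground := rfl
  rank := S.rank
  regular := S.regular

/-- The functor `IR(r, 𝔽₂) ⥤ R(r, 𝔽₂)` sending a set of vectors to its linear matroid and an
inclusion of sets to the inclusion map. -/
def inclusionFunctor (r : ℕ) : IR r ⥤ RegularMatroid r where
  obj := toRegularMatroid
  map {S T} h :=
    { toFun := Set.inclusion (show S.carrier ⊆ T.carrier from
        (leOfHom h : S ≤ T))
      injective := Set.inclusion_injective _
      indep_iff := fun I => by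
        exact linearIndepOn_comp_iff
          (ρ := (Subtype.val : T.carrier → Fin r → ZMod 2)) (Set.inclusion_injective _) I }
  map_id _ := rfl
  map_comp _ _ := rfl

end IR

/-! ### Classifying spaces and homotopy fiber sequences -/

section Topology

universe u v

/-- The classifying space of a small category: the geometric realization of its nerve. For a poset
this is the geometric realization of the poset. -/
noncomputable abbrev classifyingSpace (C : Type u) [SmallCategory C] : TopCat.{u} :=
  SSet.toTop.obj (nerve C)

/-- The continuous map of classifying spaces induced by a functor. -/
noncomputable def classifyingMap {C D : Type u} [SmallCategory C] [SmallCategory D] (F : C ⥤ D) :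
    C(classifyingSpace C, classifyingSpace D) :=
  (SSet.toTop.map (nerveMap F)).hom

/-- The vertex of the classifying space of `C` given by an object of `C`. -/
noncomputable def vertex {C : Type u} [SmallCategory C] (X : C) : classifyingSpace C :=
  TopCat.toSSetObj₀Equiv ((sSetTopAdj.unit.app (nerve C)).app _ (ComposableArrows.mk₀ X))

/-- The homotopy fiber of `p` over `y`: pairs of a point `x` and a path from `p x` to `y`. -/
def HomotopyFiber {X : Type u} {Y : Type v} [TopologicalSpace X] [TopologicalSpace Y]
    (p : C(X, Y)) (y : Y) : Type (max u v) :=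
  {q : X × C(unitInterval, Y) // q.2 0 = p q.1 ∧ q.2 1 = y}

instance {X : Type u} {Y : Type v} [TopologicalSpace X] [TopologicalSpace Y]
    (p : C(X, Y)) (y : Y) : TopologicalSpace (HomotopyFiber p y) :=
  inferInstanceAs (TopologicalSpace {q : X × C(unitInterval, Y) // q.2 0 = p q.1 ∧ q.2 1 = y})

/-- The map to the homotopy fiber of `p` over `y` determined by `i : F → X` together with a
homotopy from `p ∘ i` to the constant map at `y`. -/
def toHomotopyFiber {F X Y : Type*} [TopologicalSpace F] [TopologicalSpace X] [TopologicalSpace Y]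
    (i : C(F, X)) (p : C(X, Y)) (y : Y)
    (H : (p.comp i).Homotopy (ContinuousMap.const F y)) : C(F, HomotopyFiber p y) where
  toFun a := ⟨(i a, (H.toContinuousMap.comp ContinuousMap.prodSwap).curry a),
    H.apply_zero a, H.apply_one a⟩
  continuous_toFun := Continuous.subtype_mk (by fun_prop) _

/-- `f` is a homotopy equivalence. -/
def IsHomotopyEquivalence {X Y : Type*} [TopologicalSpace X] [TopologicalSpace Y]
    (f : C(X, Y)) : Prop :=
  ∃ e : ContinuousMap.HomotopyEquiv X Y, e.toFun = f

/-- `F --i--> X --p--> Y` is a homotopy fiber sequence over the point `y` of `Y`: there is a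
homotopy from `p ∘ i` to the constant map at `y` for which the induced map from `F` to the homotopy
fiber of `p` over `y` is a homotopy equivalence. -/
def IsHomotopyFiberSequence {F X Y : Type*} [TopologicalSpace F] [TopologicalSpace X]
    [TopologicalSpace Y] (i : C(F, X)) (p : C(X, Y)) (y : Y) : Prop :=
  ∃ H : (p.comp i).Homotopy (ContinuousMap.const F y),
    IsHomotopyEquivalence (toHomotopyFiber i p y H)

end Topology

end RegMatroid

open RegMatroid

/-!
An object `(M, f)` of the fiber category determines a configuration of vectors in `𝔽₂ʳ` which
represents `M`: the classes of the elements of `M` in `H₁(M; 𝔽₂)`, moved to `Z` by `f`. Sending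
`(M, f)` to the set of its nonzero vectors gives a homotopy inverse of the functor from `IR(r, 𝔽₂)`
to the fiber category, since both `M` and the matroid of this set are naturally contained in the
matroid `M` with a parallel copy of each of its nonzero vectors added.

For a functor `F : C ⥤ G` to a connected groupoid, the group `Aut Z` acts on the classifying space
of `StructuredArrow Z F` with quotient `BC`. The action is a covering action: a nontrivial
automorphism moves every object to a different one, so a point is told apart from its translates by
the objects that occupy the beginning of `[0, 1]` when the barycentric coordinates of the point are
laid out as consecutive intervals. Moreover `B(StructuredArrow Z F) → BC` is the pullback along `BF`
of the covering `B(StructuredArrow Z (𝟭 G)) → BG`, whose total space is contractible because `𝟙 Z`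
is initial. A pullback of a covering with contractible total space is a homotopy fiber, by lifting
the paths in the base.
-/

namespace RegMatroid

/-! ### Maps out of classifying spaces -/

section Cells

universe u

open Simplicial Opposite

variable {C D E : Type u} [SmallCategory C] [SmallCategory D] [SmallCategory E]

/-- The characteristic map `Δⁿ → BC` of an `n`-simplex of the nerve of `C`, obtained from the unit
of the adjunction between geometric realization and singular simplicial sets. -/
noncomputable def cell {n : ℕ} (σ : Fin (n + 1) ⥤ C) :
    C(stdSimplex ℝ (Fin (n + 1)), classifyingSpace C) :=
  TopCat.toSSetObjEquiv _ (op ⦋n⦌) ((sSetTopAdj.unit.app (nerve C)).app (op ⦋n⦌) σ)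

theorem cell_map {m n : ℕ} (f : Fin (m + 1) →o Fin (n + 1)) (σ : Fin (n + 1) ⥤ C)
    (t : stdSimplex ℝ (Fin (m + 1))) :
    cell σ (stdSimplex.map f t) = cell (f.monotone.functor ⋙ σ) t := by
  have naturality :=
    congr($((sSetTopAdj.unit.app (nerve C)).naturality (SimplexCategory.mkHom f).op) σ)
  exact (congrArg (TopCat.toSSetObjEquiv _ (op ⦋m⦌) · t) naturality).symm

theorem vertex_eq_cell (X : C) (t : stdSimplex ℝ (Fin 1)) :
    vertex X = cell (ComposableArrows.mk₀ X) t := by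
  rw [Subsingleton.elim t default]
  rfl

theorem classifyingMap_cell (F : C ⥤ D) {n : ℕ} (σ : Fin (n + 1) ⥤ C)
    (t : stdSimplex ℝ (Fin (n + 1))) :
    classifyingMap F (cell σ t) = cell (σ ⋙ F) t := by
  have naturality := congr(($(sSetTopAdj.unit.naturality (nerveMap F))).app (op ⦋n⦌) σ)
  exact (congrArg (TopCat.toSSetObjEquiv _ (op ⦋n⦌) · t) naturality).symm

/-- A family of continuous maps on the cells of `BC`, compatible with faces and degeneracies. These
are the data of a continuous map out of `BC`. -/
structure CellFamily (C : Type u) [SmallCategory C] (T : Type*) [TopologicalSpace T] where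
  toFun : ∀ {n : ℕ} (_ : Fin (n + 1) ⥤ C), C(stdSimplex ℝ (Fin (n + 1)), T)
  map : ∀ {m n : ℕ} (f : Fin (m + 1) →o Fin (n + 1)) (σ : Fin (n + 1) ⥤ C)
    (t : stdSimplex ℝ (Fin (m + 1))),
    toFun σ (stdSimplex.map f t) = toFun (f.monotone.functor ⋙ σ) t

namespace CellFamily

variable {T : Type u} [TopologicalSpace T]

/-- The morphism of simplicial sets from the nerve to the singular simplicial set of `T` given by a
family of maps on cells. -/
noncomputable def toSing (φ : CellFamily C T) : nerve C ⟶ TopCat.toSSet.obj (TopCat.of T) where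
  app n := ↾fun σ => (TopCat.toSSetObjEquiv (TopCat.of T) n).symm (φ.toFun (n := n.unop.len) σ)
  naturality {m n} f := by
    ext σ
    apply (TopCat.toSSetObjEquiv (TopCat.of T) n).injective
    ext t
    exact (φ.map f.unop.toOrderHom σ t).symm

/-- The continuous map out of the classifying space glued from a family of maps on cells. -/
noncomputable def desc (φ : CellFamily C T) : C(classifyingSpace C, T) :=
  ((sSetTopAdj.homEquiv (nerve C) (TopCat.of T)).symm φ.toSing).hom

theorem desc_cell (φ : CellFamily C T) {n : ℕ} (σ : Fin (n + 1) ⥤ C)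
    (t : stdSimplex ℝ (Fin (n + 1))) : φ.desc (cell σ t) = φ.toFun σ t := by
  have h := (sSetTopAdj.homEquiv (nerve C) (TopCat.of T)).apply_symm_apply φ.toSing
  rw [Adjunction.homEquiv_unit] at h
  exact congrArg (TopCat.toSSetObjEquiv _ (op ⦋n⦌) · t) congr(($h).app (op ⦋n⦌) σ)

end CellFamily

theorem continuousMap_ext_cell {T : Type u} [TopologicalSpace T] {f g : C(classifyingSpace C, T)}
    (h : ∀ (n : ℕ) (σ : Fin (n + 1) ⥤ C) (t : stdSimplex ℝ (Fin (n + 1))),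
      f (cell σ t) = g (cell σ t)) : f = g := by
  have : TopCat.ofHom f = TopCat.ofHom g := by
    apply (sSetTopAdj.homEquiv (nerve C) (TopCat.of T)).injective
    rw [Adjunction.homEquiv_unit, Adjunction.homEquiv_unit]
    ext n σ
    apply (TopCat.toSSetObjEquiv (TopCat.of T) n).injective
    ext t
    exact h _ σ t
  exact congrArg TopCat.Hom.hom this

theorem exists_cell_eq (x : classifyingSpace C) :
    ∃ (n : ℕ) (σ : Fin (n + 1) ⥤ C) (t : stdSimplex ℝ (Fin (n + 1))), cell σ t = x := by
  -- The indicator function of the union of the cells, valued in an indiscrete space, is a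
  -- continuous map that agrees with a constant map on all cells.
  let _ : TopologicalSpace (ULift.{u} Prop) := ⊤
  let isCovered : C(classifyingSpace C, ULift.{u} Prop) :=
    ⟨fun x => ⟨∃ (n : ℕ) (σ : Fin (n + 1) ⥤ C) (t : stdSimplex ℝ (Fin (n + 1))), cell σ t = x⟩,
      continuous_top⟩
  have h : isCovered = ⟨fun _ => ⟨True⟩, continuous_top⟩ :=
    continuousMap_ext_cell fun n σ t => ULift.ext _ _ (eq_true ⟨n, σ, t, rfl⟩)
  exact of_eq_true (congrArg ULift.down (DFunLike.congr_fun h x))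

theorem classifyingMap_comp (F : C ⥤ D) (G : D ⥤ E) :
    classifyingMap (F ⋙ G) = (classifyingMap G).comp (classifyingMap F) :=
  continuousMap_ext_cell fun n σ t => by
    simp only [ContinuousMap.comp_apply, classifyingMap_cell, Functor.assoc]

theorem classifyingMap_id : classifyingMap (𝟭 C) = ContinuousMap.id _ :=
  continuousMap_ext_cell fun n σ t => by
    rw [classifyingMap_cell, Functor.comp_id, ContinuousMap.id_apply]

end Cells

/-! ### Cells indexed by finite posets -/

section OrderComplex

section StdSimplex

variable {X Y : Type*} [Fintype X] [Fintype Y]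

theorem stdSimplex_map_apply [DecidableEq Y] (f : X → Y) (t : stdSimplex ℝ X) (y : Y) :
    stdSimplex.map f t y = ∑ x with f x = y, t x := by
  rw [stdSimplex.map_coe, FunOnFinite.linearMap_apply_apply]

theorem stdSimplex_map_apply_of_injective {f : X → Y} (hf : Function.Injective f)
    (t : stdSimplex ℝ X) (x : X) : stdSimplex.map f t (f x) = t x := by
  classical
  rw [stdSimplex_map_apply, Finset.sum_eq_single x] <;> simp +contextual [hf.eq_iff]

theorem stdSimplex_map_injective {f : X → Y} (hf : Function.Injective f) :
    Function.Injective (stdSimplex.map (S := ℝ) f) := fun s t h =>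
  stdSimplex.ext <| funext fun x => by
    rw [← stdSimplex_map_apply_of_injective hf, h, stdSimplex_map_apply_of_injective hf]

theorem stdSimplex_map_apply_ne_zero_iff (f : X → Y) (t : stdSimplex ℝ X) (y : Y) :
    stdSimplex.map f t y ≠ 0 ↔ ∃ x, f x = y ∧ t x ≠ 0 := by
  classical
  rw [stdSimplex_map_apply, Ne, Finset.sum_eq_zero_iff_of_nonneg fun x _ => stdSimplex.zero_le t x]
  simp

theorem stdSimplex_map_apply_of_notMem_range {f : X → Y} {y : Y} (hy : y ∉ Set.range f)
    (t : stdSimplex ℝ X) : stdSimplex.map f t y = 0 := by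
  by_contra h
  obtain ⟨x, hx, -⟩ := (stdSimplex_map_apply_ne_zero_iff f t y).1 h
  exact hy ⟨x, hx⟩

theorem sum_stdSimplex_map [DecidableEq Y] (f : X → Y) (t : stdSimplex ℝ X) (s : Finset Y) :
    ∑ y ∈ s, stdSimplex.map f t y = ∑ x with f x ∈ s, t x := by
  simp only [stdSimplex_map_apply, Finset.sum_fiberwise_eq_sum_filter]

theorem sum_stdSimplex_mono (t : stdSimplex ℝ X) {s s' : Finset X} (h : s ⊆ s') :
    ∑ x ∈ s, t x ≤ ∑ x ∈ s', t x :=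
  Finset.sum_le_sum_of_subset_of_nonneg h fun x _ _ => stdSimplex.zero_le t x

theorem sum_stdSimplex_mem_Icc (t : stdSimplex ℝ X) (s : Finset X) :
    ∑ x ∈ s, t x ∈ Set.Icc (0 : ℝ) 1 :=
  ⟨Finset.sum_nonneg fun x _ => stdSimplex.zero_le t x,
    (sum_stdSimplex_mono t s.subset_univ).trans (stdSimplex.sum_eq_one t).le⟩

theorem continuous_stdSimplex_apply (x : X) : Continuous fun t : stdSimplex ℝ X => t x :=
  (continuous_apply x).comp continuous_subtype_val

end StdSimplex

universe u

variable {D : Type u} [SmallCategory D]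

section ChainCell

variable {P : Type*} [Preorder P]

/-- The characteristic map of the image under `H : P ⥤ D` of the chain `a` in the poset `P`. -/
noncomputable def chainCell (H : P ⥤ D) {n : ℕ} (a : Fin (n + 1) →o P) :
    C(stdSimplex ℝ (Fin (n + 1)), classifyingSpace D) :=
  cell (a.monotone.functor ⋙ H)

theorem chainCell_map (H : P ⥤ D) {m n : ℕ} (a : Fin (n + 1) →o P)
    (f : Fin (m + 1) →o Fin (n + 1)) (t : stdSimplex ℝ (Fin (m + 1))) :
    chainCell H a (stdSimplex.map f t) = chainCell H (a.comp f) t :=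
  cell_map f _ t

theorem chainCell_const (X : D) {n : ℕ} (a : Fin (n + 1) →o P) (t : stdSimplex ℝ (Fin (n + 1))) :
    chainCell ((Functor.const P).obj X) a t = vertex X := by
  rw [vertex_eq_cell X (stdSimplex.map (OrderHom.const (Fin (n + 1)) (0 : Fin 1)) t), cell_map]
  rfl

end ChainCell

variable {P : Type*} [Fintype P] [PartialOrder P]

/-- The geometric realization of the order complex of a finite poset `P`: the points of the full
simplex on `P` whose support is a chain. -/
def orderComplex (P : Type*) [Fintype P] [PartialOrder P] : Set (stdSimplex ℝ P) :=
  {μ | IsChain (· ≤ ·) {x | μ x ≠ 0}}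

theorem map_mem_orderComplex {Q : Type*} [Fintype Q] [LinearOrder Q] (a : Q →o P)
    (t : stdSimplex ℝ Q) : stdSimplex.map a t ∈ orderComplex P := by
  intro x hx y hy _
  obtain ⟨i, rfl, -⟩ := (stdSimplex_map_apply_ne_zero_iff a t x).1 hx
  obtain ⟨j, rfl, -⟩ := (stdSimplex_map_apply_ne_zero_iff a t y).1 hy
  exact (le_total i j).imp (fun h => a.monotone h) fun h => a.monotone h

theorem exists_strictMono_map_eq {μ : stdSimplex ℝ P} (hμ : μ ∈ orderComplex P) :
    ∃ (n : ℕ) (s : Fin (n + 1) →o P) (v : stdSimplex ℝ (Fin (n + 1))),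
      StrictMono s ∧ (∀ i, v i ≠ 0) ∧ stdSimplex.map s v = μ := by
  classical
  let S : Set P := {x | μ x ≠ 0}
  let _ : LinearOrder S := IsChain.linearOrder (s := S) hμ
  have sum_support : ∑ x : S, μ x = 1 := by
    rw [← stdSimplex.sum_eq_one μ]
    exact (Finset.sum_subtype {x | μ x ≠ 0} (by simp [S]) μ).symm.trans
      (Finset.sum_filter_ne_zero Finset.univ)
  let ν : stdSimplex ℝ S := ⟨fun x => μ x, fun x => stdSimplex.zero_le μ x, sum_support⟩
  have map_val : stdSimplex.map Subtype.val ν = μ := by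
    ext x
    by_cases hx : μ x = 0
    · rw [hx, ← not_ne_iff, stdSimplex_map_apply_ne_zero_iff]
      rintro ⟨⟨y, hy⟩, rfl, -⟩
      exact hy hx
    · exact stdSimplex_map_apply_of_injective Subtype.val_injective ν ⟨x, hx⟩
  have : Nonempty S := by
    by_contra! h
    simp at sum_support
  obtain ⟨n, hn⟩ := Nat.exists_eq_add_one.2 (Fintype.card_pos (α := S))
  let e : Fin (n + 1) ≃o S := monoEquivOfFin S hn
  refine ⟨n, ⟨fun i => e i, fun i j h => e.monotone h⟩, stdSimplex.map e.symm ν,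
    fun i j h => e.strictMono h, fun i => ?_, ?_⟩
  · obtain ⟨x, rfl⟩ := e.symm.surjective i
    rw [stdSimplex_map_apply_of_injective e.symm.injective]
    exact x.2
  · rw [stdSimplex.map_comp_apply]
    refine Eq.trans (congrArg (stdSimplex.map · ν) (funext fun x => ?_)) map_val
    exact congrArg Subtype.val (e.apply_symm_apply x)

theorem exists_comp_eq_of_map_eq {m n : ℕ} (a : Fin (m + 1) →o P) {s : Fin (n + 1) →o P}
    (hs : StrictMono s) {u : stdSimplex ℝ (Fin (m + 1))} {v : stdSimplex ℝ (Fin (n + 1))}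
    (hu : ∀ i, u i ≠ 0) (h : stdSimplex.map a u = stdSimplex.map s v) :
    ∃ f : Fin (m + 1) →o Fin (n + 1), s.comp f = a := by
  have mem_range (i) : ∃ k, s k = a i := by
    have : stdSimplex.map s v (a i) ≠ 0 := by
      rw [← h, stdSimplex_map_apply_ne_zero_iff]
      exact ⟨i, rfl, hu i⟩
    obtain ⟨k, hk, -⟩ := (stdSimplex_map_apply_ne_zero_iff s v _).1 this
    exact ⟨k, hk⟩
  choose f hf using mem_range
  have f_monotone : Monotone f := fun i j hij => by
    rw [← hs.le_iff_le, hf, hf]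
    exact a.monotone hij
  exact ⟨⟨f, f_monotone⟩, OrderHom.ext _ _ (funext hf)⟩

theorem chainCell_eq_of_map_eq_of_strictMono (H : P ⥤ D) {m n : ℕ} (a : Fin (m + 1) →o P)
    {s : Fin (n + 1) →o P} (hs : StrictMono s) {u : stdSimplex ℝ (Fin (m + 1))}
    {v : stdSimplex ℝ (Fin (n + 1))} (h : stdSimplex.map a u = stdSimplex.map s v) :
    chainCell H a u = chainCell H s v := by
  obtain ⟨l, i, w, -, w_ne_zero, hw⟩ :=
    exists_strictMono_map_eq (map_mem_orderComplex OrderHom.id u)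
  obtain rfl : stdSimplex.map i w = u := hw.trans (stdSimplex.map_id_apply u)
  have map_comp_eq : stdSimplex.map (a.comp i) w = stdSimplex.map s v := by
    rw [← h, stdSimplex.map_comp_apply, OrderHom.comp_coe]
  obtain ⟨f, hf⟩ := exists_comp_eq_of_map_eq (a.comp i) hs w_ne_zero map_comp_eq
  obtain rfl : stdSimplex.map f w = v := stdSimplex_map_injective hs.injective <| by
    rw [← map_comp_eq, ← hf, stdSimplex.map_comp_apply, OrderHom.comp_coe]
  rw [chainCell_map, chainCell_map, hf]

theorem exists_chainCell_eq_of_map_eq (H : P ⥤ D) (μ : orderComplex P) :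
    ∃ x, ∀ (n : ℕ) (a : Fin (n + 1) →o P) (t : stdSimplex ℝ (Fin (n + 1))),
      stdSimplex.map a t = μ → chainCell H a t = x := by
  obtain ⟨n, s, v, hs, -, hv⟩ := exists_strictMono_map_eq μ.2
  exact ⟨_, fun m a t ht => chainCell_eq_of_map_eq_of_strictMono H a hs (ht.trans hv.symm)⟩

/-- The map onto the order complex of `P` from the disjoint union of all simplices of `P` of
dimension less than the cardinality of `P`. -/
noncomputable def orderComplexRealize
    (x : Σ s : (Σ n : Fin (Fintype.card P), Fin (n + 1) →o P), stdSimplex ℝ (Fin (s.1 + 1))) :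
    orderComplex P :=
  ⟨stdSimplex.map x.1.2 x.2, map_mem_orderComplex x.1.2 x.2⟩

theorem orderComplexRealize_surjective : (orderComplexRealize (P := P)).Surjective := fun μ => by
  obtain ⟨n, s, v, hs, -, hv⟩ := exists_strictMono_map_eq μ.2
  have n_lt_card : n < Fintype.card P := by
    simpa using Fintype.card_le_of_injective s hs.injective
  exact ⟨⟨⟨⟨n, n_lt_card⟩, s⟩, v⟩, Subtype.ext hv⟩

theorem continuous_orderComplexRealize : Continuous (orderComplexRealize (P := P)) :=
  continuous_sigma fun s => (stdSimplex.continuous_map s.2).subtype_mk _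

theorem isQuotientMap_orderComplexRealize :
    Topology.IsQuotientMap (orderComplexRealize (P := P)) := by
  have (n : Fin (Fintype.card P)) : Finite (Fin (n + 1) →o P) := DFunLike.finite _
  exact .of_surjective_continuous orderComplexRealize_surjective continuous_orderComplexRealize

theorem continuous_orderComplex {T : Type*} [TopologicalSpace T] {g : orderComplex P → T}
    (hg : ∀ (n : ℕ) (a : Fin (n + 1) →o P),
      Continuous fun t => g ⟨stdSimplex.map a t, map_mem_orderComplex a t⟩) : Continuous g :=
  isQuotientMap_orderComplexRealize.continuous_iff.2 <| continuous_sigma fun s => hg _ s.2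

/-- The map `|P| → BD` induced by a functor `H : P ⥤ D` on a finite poset `P`, on the order complex
model of `|P|`. -/
noncomputable def orderComplexMap (H : P ⥤ D) : C(orderComplex P, classifyingSpace D) where
  toFun μ := (exists_chainCell_eq_of_map_eq H μ).choose
  continuous_toFun := continuous_orderComplex fun n a =>
    (chainCell H a).continuous.congr fun t =>
      (exists_chainCell_eq_of_map_eq H _).choose_spec n a t rfl

theorem orderComplexMap_eq_chainCell (H : P ⥤ D) {μ : orderComplex P} {n : ℕ}
    (a : Fin (n + 1) →o P) {t : stdSimplex ℝ (Fin (n + 1))} (h : stdSimplex.map a t = μ) :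
    orderComplexMap H μ = chainCell H a t :=
  ((exists_chainCell_eq_of_map_eq H μ).choose_spec n a t h).symm

theorem orderComplexMap_const (X : D) (μ : orderComplex P) :
    orderComplexMap ((Functor.const P).obj X) μ = vertex X := by
  obtain ⟨n, s, v, -, -, hv⟩ := exists_strictMono_map_eq μ.2
  rw [orderComplexMap_eq_chainCell _ s hv, chainCell_const]

theorem orderComplexMap_comp {Q : Type*} [Fintype Q] [PartialOrder Q] (H : P ⥤ D) (f : Q →o P)
    {ν : orderComplex Q} {μ : orderComplex P} (h : stdSimplex.map f (ν : stdSimplex ℝ Q) = μ) :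
    orderComplexMap (f.monotone.functor ⋙ H) ν = orderComplexMap H μ := by
  obtain ⟨n, s, v, -, -, hv⟩ := exists_strictMono_map_eq ν.2
  rw [orderComplexMap_eq_chainCell _ s hv, orderComplexMap_eq_chainCell H (f.comp s) (t := v)]
  · rfl
  · rw [← h, ← hv, stdSimplex.map_comp_apply, OrderHom.comp_coe]

end OrderComplex

/-! ### Increments of a function along the partial sums of barycentric coordinates -/

section Increment

variable {P Q : Type*} [Fintype P] [Fintype Q] [LinearOrder P] [LinearOrder Q]

/-- The increment of `h : ℝ → ℝ` over the subinterval of `[0, 1]` that belongs to `i` when `[0, 1]`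
is cut into consecutive intervals whose lengths are the barycentric coordinates of `t`. -/
noncomputable def increment (h : ℝ → ℝ) (t : stdSimplex ℝ Q) (i : Q) : ℝ :=
  h (∑ j with j ≤ i, t j) - h (∑ j with j < i, t j)

theorem increment_congr {h h' : ℝ → ℝ} (hh : Set.EqOn h h' (Set.Icc 0 1)) (t : stdSimplex ℝ Q)
    (i : Q) : increment h t i = increment h' t i := by
  simp only [increment, hh (sum_stdSimplex_mem_Icc t _)]

theorem increment_const (c : ℝ) (t : stdSimplex ℝ Q) (i : Q) : increment (fun _ => c) t i = 0 :=
  sub_self c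

theorem increment_id (t : stdSimplex ℝ Q) (i : Q) : increment id t i = t i := by
  have insert_eq : insert i ({j | j < i} : Finset Q) = ({j | j ≤ i} : Finset Q) := by
    ext j
    simp [le_iff_eq_or_lt]
  rw [increment, ← insert_eq, Finset.sum_insert (by simp), id, id, add_sub_cancel_right]

theorem increment_nonneg {h : ℝ → ℝ} (hh : Monotone h) (t : stdSimplex ℝ Q) (i : Q) :
    0 ≤ increment h t i :=
  sub_nonneg.2 <| hh <| sum_stdSimplex_mono t <| Finset.monotone_filter_right _ fun _ _ => le_of_lt

theorem sum_increment_of_isLowerSet (h : ℝ → ℝ) (t : stdSimplex ℝ Q) {s : Finset Q}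
    (hs : IsLowerSet (s : Set Q)) : ∑ i ∈ s, increment h t i = h (∑ i ∈ s, t i) - h 0 := by
  induction s using Finset.induction_on_max with
  | empty => simp
  | insert a s ha ih =>
    have lt_iff (j : Q) : j < a ↔ j ∈ s := by
      refine ⟨fun hj => ?_, ha j⟩
      have : j ∈ insert a s := hs hj.le (Finset.mem_insert_self a s)
      exact (Finset.mem_insert.1 this).resolve_left hj.ne
    have eq_lt : ({j | j < a} : Finset Q) = s := by ext j; simp [lt_iff]
    have eq_le : ({j | j ≤ a} : Finset Q) = insert a s := by
      ext j
      simp [le_iff_eq_or_lt, lt_iff]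
    have s_lower : IsLowerSet (s : Set Q) := fun i j hji hi =>
      (lt_iff j).1 (hji.trans_lt ((lt_iff i).2 hi))
    rw [Finset.sum_insert fun h => (ha a h).false, ih s_lower, increment, eq_lt, eq_le]
    ring

theorem sum_increment (h : ℝ → ℝ) (t : stdSimplex ℝ Q) : ∑ i, increment h t i = h 1 - h 0 := by
  rw [sum_increment_of_isLowerSet h t (by simpa using isLowerSet_univ), stdSimplex.sum_eq_one]

theorem increment_map (h : ℝ → ℝ) (f : P →o Q) (t : stdSimplex ℝ P) (j : Q) :
    increment h (stdSimplex.map f t) j = ∑ i with f i = j, increment h t i := by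
  have lower_le : IsLowerSet (({i | f i ≤ j} : Finset P) : Set P) := fun a b hba ha => by
    simpa using (f.monotone hba).trans (by simpa using ha)
  have lower_lt : IsLowerSet (({i | f i < j} : Finset P) : Set P) := fun a b hba ha => by
    simpa using (f.monotone hba).trans_lt (by simpa using ha)
  rw [increment, sum_stdSimplex_map, sum_stdSimplex_map]
  simp only [Finset.mem_filter, Finset.mem_univ, true_and]
  rw [← sub_sub_sub_cancel_right _ _ (h 0), ← sum_increment_of_isLowerSet h t lower_le,
    ← sum_increment_of_isLowerSet h t lower_lt, sub_eq_iff_eq_add, ← Finset.sum_union]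
  · congr 1
    ext i
    simp [le_iff_eq_or_lt]
  · exact Finset.disjoint_filter.2 fun i _ h h' => h'.ne h

theorem continuous_increment {X : Type*} [TopologicalSpace X] {h : X → ℝ → ℝ}
    (hh : Continuous fun p : X × ℝ => h p.1 p.2) (i : Q) :
    Continuous fun p : stdSimplex ℝ Q × X => increment (h p.2) p.1 i := by
  have := continuous_stdSimplex_apply (X := Q)
  unfold increment
  fun_prop

theorem continuous_increment_right {h : ℝ → ℝ} (hh : Continuous h) (i : Q) :
    Continuous fun t : stdSimplex ℝ Q => increment h t i :=
  (continuous_increment (X := Unit) (h := fun _ => h) (by fun_prop) i).comp (.prodMk_left ())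

end Increment

/-! ### Homotopies from natural transformations -/

section Coupling

variable {P Q : Type*} [Fintype P] [Fintype Q] [LinearOrder P] [LinearOrder Q]

/-- The monotone coupling of the point `(1 - s, s)` of the simplex on `Fin 2` with a point `t` of
the simplex on `Q`: it cuts `[0, 1]` at `1 - s` and into the intervals given by `t`. -/
noncomputable def coupling (t : stdSimplex ℝ Q) (s : unitInterval) : stdSimplex ℝ (Fin 2 × Q) where
  val x := increment (![(min · (1 - s : ℝ)), (max · (1 - s : ℝ))] x.1) t x.2
  property := by
    refine ⟨fun x => increment_nonneg ?_ t x.2, ?_⟩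
    · have min_monotone : Monotone (min · (1 - s : ℝ)) := fun _ _ h => min_le_min_right _ h
      have max_monotone : Monotone (max · (1 - s : ℝ)) := fun _ _ h => max_le_max_right _ h
      exact Fin.cases min_monotone (Fin.cases max_monotone fun i => i.elim0) x.1
    · have one_sub_mem : 0 ≤ (1 - s : ℝ) ∧ (1 - s : ℝ) ≤ 1 := (unitInterval.symm s).2
      simp [Fintype.sum_prod_type, sum_increment, one_sub_mem]

theorem coupling_zero_apply (t : stdSimplex ℝ Q) (s : unitInterval) (i : Q) :
    coupling t s (0, i) = increment (min · (1 - s : ℝ)) t i := rfl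

theorem coupling_one_apply (t : stdSimplex ℝ Q) (s : unitInterval) (i : Q) :
    coupling t s (1, i) = increment (max · (1 - s : ℝ)) t i := rfl

theorem le_of_coupling_ne_zero {t : stdSimplex ℝ Q} {s : unitInterval} {i j : Q}
    (hi : coupling t s (0, i) ≠ 0) (hj : coupling t s (1, j) ≠ 0) : i ≤ j := by
  contrapose! hi
  have upper_le_lower : ∑ k with k ≤ j, t k ≤ ∑ k with k < i, t k :=
    sum_stdSimplex_mono t <| Finset.monotone_filter_right _ fun _ _ hk => hk.trans_lt hi
  have lt_upper : 1 - s < ∑ k with k ≤ j, t k := by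
    by_contra! upper_le
    have lower_le : ∑ k with k < j, t k ≤ 1 - s := (sum_stdSimplex_mono t <|
      Finset.monotone_filter_right _ fun _ _ => le_of_lt).trans upper_le
    rw [coupling_one_apply, increment, max_eq_right upper_le, max_eq_right lower_le] at hj
    exact hj (sub_self _)
  have le_lower : 1 - s ≤ ∑ k with k < i, t k := lt_upper.le.trans upper_le_lower
  have le_upper : 1 - s ≤ ∑ k with k ≤ i, t k := le_lower.trans <| sum_stdSimplex_mono t <|
    Finset.monotone_filter_right _ fun _ _ => le_of_lt
  rw [coupling_zero_apply, increment, min_eq_right le_lower, min_eq_right le_upper, sub_self]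

theorem coupling_mem_orderComplex (t : stdSimplex ℝ Q) (s : unitInterval) :
    coupling t s ∈ orderComplex (Fin 2 × Q) := by
  rintro ⟨e, i⟩ hi ⟨e', j⟩ hj -
  fin_cases e <;> fin_cases e'
  · exact (le_total i j).imp (fun h => ⟨le_rfl, h⟩) fun h => ⟨le_rfl, h⟩
  · exact Or.inl ⟨zero_le_one, le_of_coupling_ne_zero hi hj⟩
  · exact Or.inr ⟨zero_le_one, le_of_coupling_ne_zero hj hi⟩
  · exact (le_total i j).imp (fun h => ⟨le_rfl, h⟩) fun h => ⟨le_rfl, h⟩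

theorem coupling_map (f : P →o Q) (t : stdSimplex ℝ P) (s : unitInterval) :
    coupling (stdSimplex.map f t) s = stdSimplex.map (OrderHom.prodMap .id f) (coupling t s) := by
  ext ⟨e, j⟩
  rw [stdSimplex_map_apply]
  refine (increment_map _ f t j).trans <|
    Finset.sum_nbij' (fun i => (e, i)) Prod.snd ?_ ?_ ?_ ?_ fun _ _ => rfl <;>
  simp +contextual [Prod.ext_iff]

theorem coupling_zero (t : stdSimplex ℝ Q) : coupling t 0 = stdSimplex.map (Prod.mk 0) t := by
  ext ⟨e, i⟩
  fin_cases e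
  · refine Eq.trans ?_ (stdSimplex_map_apply_of_injective (Prod.mk_right_injective 0) t i).symm
    refine (increment_congr (fun y hy => ?_) t i).trans (increment_id t i)
    simpa using hy.2
  · refine Eq.trans ?_ (stdSimplex_map_apply_of_notMem_range (by simp) t).symm
    refine (increment_congr (fun y hy => ?_) t i).trans (increment_const 1 t i)
    simpa using hy.2

theorem coupling_one (t : stdSimplex ℝ Q) : coupling t 1 = stdSimplex.map (Prod.mk 1) t := by
  ext ⟨e, i⟩
  fin_cases e
  · refine Eq.trans ?_ (stdSimplex_map_apply_of_notMem_range (by simp) t).symm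
    refine (increment_congr (fun y hy => ?_) t i).trans (increment_const 0 t i)
    simpa using hy.1
  · refine Eq.trans ?_ (stdSimplex_map_apply_of_injective (Prod.mk_right_injective 1) t i).symm
    refine (increment_congr (fun y hy => ?_) t i).trans (increment_id t i)
    simpa using hy.1

theorem continuous_coupling :
    Continuous fun p : stdSimplex ℝ Q × unitInterval => coupling p.1 p.2 := by
  refine Continuous.subtype_mk (continuous_pi fun ⟨e, i⟩ => ?_) _
  fin_cases e
  · exact continuous_increment (h := fun (s : unitInterval) => (min · (1 - s : ℝ))) (by fun_prop) i
  · exact continuous_increment (h := fun (s : unitInterval) => (max · (1 - s : ℝ))) (by fun_prop) i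

end Coupling

section NaturalTransformations

universe u

variable {C D : Type u} [SmallCategory C] [SmallCategory D] {F G : C ⥤ D}

/-- The category structure on a product of preorders given by the product order. It is preferred to
the product of categories, so that chains in the product are monotone maps. -/
abbrev prodPreorderCategory (P Q : Type*) [Preorder P] [Preorder Q] : SmallCategory (P × Q) :=
  Preorder.smallCategory (P × Q)

attribute [local instance] prodPreorderCategory

/-- The prism in `D` spanned by the images of a simplex of `C` under the source and the target of a
natural transformation. -/
def prism (α : F ⟶ G) {n : ℕ} (σ : Fin (n + 1) ⥤ C) : Fin 2 × Fin (n + 1) ⥤ D :=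
  OrderHom.fst.monotone.functor.prod' (OrderHom.snd.monotone.functor ⋙ σ) ⋙
    Functor.uncurry.obj (ComposableArrows.mk₁ α)

/-- The inclusion of the bottom (`e = 0`) or top (`e = 1`) face of a prism. -/
def prismFace (e : Fin 2) (n : ℕ) : Fin (n + 1) →o Fin 2 × Fin (n + 1) :=
  (OrderHom.const _ e).prod .id

theorem prismFace_zero_comp_prism (α : F ⟶ G) {n : ℕ} (σ : Fin (n + 1) ⥤ C) :
    (prismFace 0 n).monotone.functor ⋙ prism α σ = σ ⋙ F :=
  CategoryTheory.Functor.ext (fun _ => rfl) fun _ _ h =>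
    (Category.id_comp (F.map (σ.map h))).trans
      ((Category.id_comp _).trans (Category.comp_id _)).symm

theorem prismFace_one_comp_prism (α : F ⟶ G) {n : ℕ} (σ : Fin (n + 1) ⥤ C) :
    (prismFace 1 n).monotone.functor ⋙ prism α σ = σ ⋙ G :=
  CategoryTheory.Functor.ext (fun _ => rfl) fun _ _ h =>
    (Category.id_comp (G.map (σ.map h))).trans
      ((Category.id_comp _).trans (Category.comp_id _)).symm

/-- The homotopy on a cell of `BC` given by a natural transformation. -/
noncomputable def prismMap (α : F ⟶ G) {n : ℕ} (σ : Fin (n + 1) ⥤ C) :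
    C(stdSimplex ℝ (Fin (n + 1)) × unitInterval, classifyingSpace D) :=
  (orderComplexMap (prism α σ)).comp
    ⟨fun p => ⟨coupling p.1 p.2, coupling_mem_orderComplex p.1 p.2⟩,
      continuous_coupling.subtype_mk _⟩

theorem prismMap_apply (α : F ⟶ G) {n : ℕ} (σ : Fin (n + 1) ⥤ C)
    (t : stdSimplex ℝ (Fin (n + 1))) (s : unitInterval) : prismMap α σ (t, s) =
      orderComplexMap (prism α σ) ⟨coupling t s, coupling_mem_orderComplex t s⟩ := rfl

theorem prism_precomp (α : F ⟶ G) {m n : ℕ} (f : Fin (m + 1) →o Fin (n + 1))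
    (σ : Fin (n + 1) ⥤ C) : prism α (f.monotone.functor ⋙ σ) =
      (OrderHom.prodMap .id f).monotone.functor ⋙ prism α σ := rfl

theorem prismMap_map (α : F ⟶ G) {m n : ℕ} (f : Fin (m + 1) →o Fin (n + 1)) (σ : Fin (n + 1) ⥤ C)
    (t : stdSimplex ℝ (Fin (m + 1))) (s : unitInterval) :
    prismMap α σ (stdSimplex.map f t, s) = prismMap α (f.monotone.functor ⋙ σ) (t, s) := by
  rw [prismMap_apply, prismMap_apply, prism_precomp]
  have comp_eq := orderComplexMap_comp (prism α σ) (OrderHom.prodMap .id f)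
    (ν := ⟨_, coupling_mem_orderComplex t s⟩)
    (μ := ⟨_, coupling_mem_orderComplex (stdSimplex.map f t) s⟩)
  exact (comp_eq (coupling_map f t s).symm).symm

theorem prismMap_zero (α : F ⟶ G) {n : ℕ} (σ : Fin (n + 1) ⥤ C)
    (t : stdSimplex ℝ (Fin (n + 1))) : prismMap α σ (t, 0) = cell (σ ⋙ F) t := by
  rw [← prismFace_zero_comp_prism α, prismMap_apply]
  exact orderComplexMap_eq_chainCell _ (prismFace 0 n) (coupling_zero t).symm

theorem prismMap_one (α : F ⟶ G) {n : ℕ} (σ : Fin (n + 1) ⥤ C)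
    (t : stdSimplex ℝ (Fin (n + 1))) : prismMap α σ (t, 1) = cell (σ ⋙ G) t := by
  rw [← prismFace_one_comp_prism α, prismMap_apply]
  exact orderComplexMap_eq_chainCell _ (prismFace 1 n) (coupling_one t).symm

/-- The homotopies on the cells of `BC` given by a natural transformation. -/
noncomputable def prismFamily (α : F ⟶ G) : CellFamily C C(unitInterval, classifyingSpace D) where
  toFun σ := (prismMap α σ).curry
  map f σ t := ContinuousMap.ext fun s => prismMap_map α f σ t s

/-- The homotopy of maps of classifying spaces given by a natural transformation. -/
noncomputable def natTransHomotopy (α : F ⟶ G) :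
    (classifyingMap F).Homotopy (classifyingMap G) where
  toContinuousMap := (prismFamily α).desc.uncurry.comp ContinuousMap.prodSwap
  map_zero_left x := by
    obtain ⟨n, σ, t, rfl⟩ := exists_cell_eq x
    rw [classifyingMap_cell, ← prismMap_zero α]
    exact DFunLike.congr_fun ((prismFamily α).desc_cell σ t) 0
  map_one_left x := by
    obtain ⟨n, σ, t, rfl⟩ := exists_cell_eq x
    rw [classifyingMap_cell, ← prismMap_one α]
    exact DFunLike.congr_fun ((prismFamily α).desc_cell σ t) 1

theorem natTransHomotopy_cell (α : F ⟶ G) {n : ℕ} (σ : Fin (n + 1) ⥤ C)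
    (t : stdSimplex ℝ (Fin (n + 1))) (s : unitInterval) :
    natTransHomotopy α (s, cell σ t) = prismMap α σ (t, s) :=
  DFunLike.congr_fun ((prismFamily α).desc_cell σ t) s

theorem homotopic_of_natTrans (α : F ⟶ G) : (classifyingMap F).Homotopic (classifyingMap G) :=
  ⟨natTransHomotopy α⟩

theorem prism_mk₀ (α : F ⟶ G) (X : C) (h : F.obj X = G.obj X) (hα : α.app X = eqToHom h) :
    prism α (ComposableArrows.mk₀ X) = (Functor.const _).obj (F.obj X) := by
  have obj_eq (x : Fin 2 × Fin 1) :
      (prism α (ComposableArrows.mk₀ X)).obj x = ((Functor.const _).obj (F.obj X)).obj x := by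
    obtain ⟨e, i⟩ := x
    fin_cases e
    exacts [rfl, h.symm]
  refine CategoryTheory.Functor.ext obj_eq fun x y f => ?_
  obtain ⟨e, i⟩ := x
  obtain ⟨e', j⟩ := y
  obtain rfl : i = j := Subsingleton.elim (α := Fin 1) i j
  fin_cases e <;> fin_cases e'
  · refine (Category.id_comp (F.map (𝟙 X))).trans ?_
    rw [F.map_id]
    exact ((Category.id_comp _).trans (Category.id_comp _)).symm
  · refine (congrArg (· ≫ G.map (𝟙 X)) hα).trans ?_
    rw [G.map_id]
    exact (Category.comp_id _).trans ((Category.id_comp _).trans (Category.id_comp _)).symm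
  · exact absurd f.le.1 (by simp)
  · refine (Category.id_comp (G.map (𝟙 X))).trans ?_
    rw [G.map_id]
    exact (by simp : 𝟙 (G.obj X) = eqToHom h.symm ≫ 𝟙 (F.obj X) ≫ eqToHom h)

theorem natTransHomotopy_vertex (α : F ⟶ G) (X : C) (h : F.obj X = G.obj X)
    (hα : α.app X = eqToHom h) (s : unitInterval) :
    natTransHomotopy α (s, vertex X) = vertex (F.obj X) := by
  rw [vertex_eq_cell X default, natTransHomotopy_cell, prismMap_apply, prism_mk₀ α X h hα]
  exact orderComplexMap_const (F.obj X) _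

end NaturalTransformations

/-! ### Separating a point from its translates -/

section Occupation

universe u

variable {C : Type u} [SmallCategory C]

open Classical in
/-- The functions on the cells of `BC` that measure the part of `[0, c]` occupied by the vertices
satisfying `p`, when `[0, 1]` is cut into consecutive intervals, one for each vertex, whose lengths
are the barycentric coordinates. -/
noncomputable def occupationFamily (p : C → Prop) (c : ℝ) : CellFamily C (ULift.{u} ℝ) where
  toFun σ := ⟨fun t => ⟨∑ i with p (σ.obj i), increment (min · c) t i⟩,
    continuous_uliftUp.comp <| continuous_finsetSum _ fun i _ =>
      continuous_increment_right (by fun_prop) i⟩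
  map f σ t := congrArg ULift.up <| by
    simp only [increment_map, Finset.sum_fiberwise_eq_sum_filter, Finset.mem_filter,
      Finset.mem_univ, true_and]
    rfl

/-- The length of the part of `[0, c]` occupied by the vertices satisfying `p`. -/
noncomputable def occupation (p : C → Prop) (c : ℝ) (x : classifyingSpace C) : ℝ :=
  ((occupationFamily p c).desc x).down

theorem continuous_occupation (p : C → Prop) (c : ℝ) : Continuous (occupation p c) :=
  continuous_uliftDown.comp (ContinuousMap.continuous _)

open Classical in
theorem occupation_cell (p : C → Prop) (c : ℝ) {n : ℕ} (σ : Fin (n + 1) ⥤ C)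
    (t : stdSimplex ℝ (Fin (n + 1))) :
    occupation p c (cell σ t) = ∑ i with p (σ.obj i), increment (min · c) t i :=
  congrArg ULift.down (CellFamily.desc_cell _ σ t)

theorem monotone_min_right (c : ℝ) : Monotone (min · c) := fun _ _ h => min_le_min_right c h

theorem exists_half_lt_occupation (x : classifyingSpace C) :
    ∃ (X : C) (c : ℝ), 0 < c ∧ ∀ p : C → Prop, p X → c / 2 < occupation p c x := by
  classical
  obtain ⟨n, σ, t, rfl⟩ := exists_cell_eq x
  have nonempty_support : {i | t i ≠ 0}.Nonempty := by
    by_contra! h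
    rw [Set.eq_empty_iff_forall_notMem] at h
    simpa [not_not.1 (h _)] using stdSimplex.sum_eq_one t
  obtain ⟨i, i_support, i_min⟩ := wellFounded_lt.has_min _ nonempty_support
  have lower_eq_zero : ∑ j with j < i, t j = 0 :=
    Finset.sum_eq_zero fun j hj => not_not.1 fun h => i_min j h (Finset.mem_filter.1 hj).2
  have increment_eq : increment (min · (t i)) t i = t i := by
    have upper_eq := increment_id t i
    rw [increment, lower_eq_zero, id, id, sub_zero] at upper_eq
    rw [increment, lower_eq_zero, upper_eq, min_self, min_eq_left (stdSimplex.zero_le t i),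
      sub_zero]
  have pos : 0 < t i := (stdSimplex.zero_le t i).lt_of_ne' i_support
  refine ⟨σ.obj i, t i, pos, fun p hp => ?_⟩
  rw [occupation_cell]
  calc t i / 2 < t i := half_lt_self pos
    _ = increment (min · (t i)) t i := increment_eq.symm
    _ ≤ _ := Finset.single_le_sum (f := increment (min · (t i)) t)
      (fun j _ => increment_nonneg (monotone_min_right _) t j) (by simpa using hp)

theorem occupation_add_le (F : C ⥤ C) {p : C → Prop} (hp : ∀ X, p X → ¬ p (F.obj X)) {c : ℝ}
    (hc : 0 ≤ c) (x : classifyingSpace C) :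
    occupation p c x + occupation p c (classifyingMap F x) ≤ c := by
  classical
  obtain ⟨n, σ, t, rfl⟩ := exists_cell_eq x
  have disjoint : Disjoint ({i | p (σ.obj i)} : Finset (Fin (n + 1)))
      ({i | p ((σ ⋙ F).obj i)} : Finset (Fin (n + 1))) :=
    Finset.disjoint_filter.2 fun i _ => hp (σ.obj i)
  rw [classifyingMap_cell, occupation_cell, occupation_cell, ← Finset.sum_union disjoint]
  calc _ ≤ ∑ i, increment (min · c) t i :=
        Finset.sum_le_sum_of_subset_of_nonneg (Finset.subset_univ _) fun i _ _ =>
          increment_nonneg (monotone_min_right c) t i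
    _ = min 1 c := by rw [sum_increment, min_eq_left hc, sub_zero]
    _ ≤ c := min_le_right 1 c

end Occupation

/-! ### The covering map from the classifying space of a fiber category -/

section Fiber

universe u

variable {C G : Type u} [SmallCategory C] [Groupoid.{u} G] {Z : G} {F : C ⥤ G}

/-- The functor to the fiber category of `F` over `Z` with prescribed projection `p` to `C` and
structure maps `f`. -/
def fiberLift {J : Type*} [Category* J] (p : J ⥤ C) (f : ∀ j, Z ⟶ F.obj (p.obj j))
    (hf : ∀ {j k} (h : j ⟶ k), f j ≫ F.map (p.map h) = f k) : J ⥤ StructuredArrow Z F where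
  obj j := StructuredArrow.mk (f j)
  map h := StructuredArrow.homMk (p.map h) (hf h)

theorem fiberLift_congr {J : Type*} [Category* J] (p : J ⥤ C) {f g : ∀ j, Z ⟶ F.obj (p.obj j)}
    (hf : ∀ {j k} (h : j ⟶ k), f j ≫ F.map (p.map h) = f k)
    (hg : ∀ {j k} (h : j ⟶ k), g j ≫ F.map (p.map h) = g k) (h : ∀ j, f j = g j) :
    fiberLift p f hf = fiberLift p g hg := by
  obtain rfl : f = g := funext h
  rfl

theorem comp_map_zero_le_comp_map {n : ℕ} (σ : Fin (n + 1) ⥤ C) (f : Z ⟶ F.obj (σ.obj 0))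
    {j k : Fin (n + 1)} (h : j ⟶ k) :
    (f ≫ F.map (σ.map (homOfLE (Fin.zero_le j)))) ≫ F.map (σ.map h) =
      f ≫ F.map (σ.map (homOfLE (Fin.zero_le k))) := by
  rw [Category.assoc, ← F.map_comp, ← σ.map_comp]; rfl

/-- The simplex of the fiber category that lies over the simplex `σ` of `C` and whose first vertex
is `f`. Every simplex of the fiber category has this form, uniquely. -/
def liftSimplex {n : ℕ} (σ : Fin (n + 1) ⥤ C) (f : Z ⟶ F.obj (σ.obj 0)) :
    Fin (n + 1) ⥤ StructuredArrow Z F :=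
  fiberLift σ (fun j => f ≫ F.map (σ.map (homOfLE (Fin.zero_le j)))) (comp_map_zero_le_comp_map σ f)

theorem eq_liftSimplex {n : ℕ} (τ : Fin (n + 1) ⥤ StructuredArrow Z F) :
    τ = liftSimplex (τ ⋙ StructuredArrow.proj Z F) (τ.obj 0).hom :=
  fiberLift_congr (τ ⋙ StructuredArrow.proj Z F) (f := fun j => (τ.obj j).hom)
    (fun h => StructuredArrow.w (τ.map h))
    (comp_map_zero_le_comp_map (τ ⋙ StructuredArrow.proj Z F) _)
    fun j => (StructuredArrow.w (τ.map (homOfLE (Fin.zero_le j)))).symm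

theorem exists_cell_liftSimplex_eq (x : classifyingSpace (StructuredArrow Z F)) :
    ∃ (n : ℕ) (σ : Fin (n + 1) ⥤ C) (f : Z ⟶ F.obj (σ.obj 0)) (t : stdSimplex ℝ (Fin (n + 1))),
      cell (liftSimplex σ f) t = x := by
  obtain ⟨n, τ, t, rfl⟩ := exists_cell_eq x
  exact ⟨n, _, _, t, congrArg (cell · t) (eq_liftSimplex τ).symm⟩

theorem liftSimplex_map {n : ℕ} (σ : Fin (n + 1) ⥤ C) (f : Z ⟶ F.obj (σ.obj 0)) (g : Z ⟶ Z) :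
    liftSimplex σ f ⋙ StructuredArrow.map g = liftSimplex σ (g ≫ f) :=
  fiberLift_congr σ (f := fun j => g ≫ f ≫ F.map (σ.map (homOfLE (Fin.zero_le j))))
    (fun h => StructuredArrow.w ((liftSimplex σ f ⋙ StructuredArrow.map g).map h))
    (comp_map_zero_le_comp_map σ _) fun _ => (Category.assoc _ _ _).symm

theorem precomp_liftSimplex {m n : ℕ} (a : Fin (m + 1) →o Fin (n + 1)) (σ : Fin (n + 1) ⥤ C)
    (f : Z ⟶ F.obj (σ.obj 0)) :
    a.monotone.functor ⋙ liftSimplex σ f = liftSimplex (a.monotone.functor ⋙ σ)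
      (f ≫ F.map (σ.map (homOfLE (Fin.zero_le (a 0))))) :=
  eq_liftSimplex (a.monotone.functor ⋙ liftSimplex σ f)

theorem classifyingMap_map_cell_liftSimplex (g : Z ⟶ Z) {n : ℕ} (σ : Fin (n + 1) ⥤ C)
    (f : Z ⟶ F.obj (σ.obj 0)) (t : stdSimplex ℝ (Fin (n + 1))) :
    classifyingMap (StructuredArrow.map g) (cell (liftSimplex σ f) t) =
      cell (liftSimplex σ (g ≫ f)) t := by
  rw [classifyingMap_cell, liftSimplex_map]

noncomputable instance mulActionAut (F : C ⥤ G) :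
    MulAction (Aut Z) (classifyingSpace (StructuredArrow Z F)) where
  smul g := classifyingMap (StructuredArrow.map g.inv)
  one_smul x := by
    obtain ⟨n, σ, f, t, rfl⟩ := exists_cell_liftSimplex_eq x
    exact (classifyingMap_map_cell_liftSimplex _ σ f t).trans
      congr(cell (liftSimplex σ $(Category.id_comp f)) t)
  mul_smul g h x := by
    obtain ⟨n, σ, f, t, rfl⟩ := exists_cell_liftSimplex_eq x
    calc classifyingMap (StructuredArrow.map (g * h).inv) (cell (liftSimplex σ f) t)
      _ = cell (liftSimplex σ (g.inv ≫ h.inv ≫ f)) t :=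
        (classifyingMap_map_cell_liftSimplex _ σ f t).trans
          congr(cell (liftSimplex σ $(Category.assoc g.inv h.inv f)) t)
      _ = classifyingMap (StructuredArrow.map g.inv)
          (classifyingMap (StructuredArrow.map h.inv) (cell (liftSimplex σ f) t)) := by
        rw [classifyingMap_map_cell_liftSimplex, classifyingMap_map_cell_liftSimplex]

theorem smul_def (g : Aut Z) (x : classifyingSpace (StructuredArrow Z F)) :
    g • x = classifyingMap (StructuredArrow.map g.inv) x := rfl

instance continuousConstSMulAut :
    ContinuousConstSMul (Aut Z) (classifyingSpace (StructuredArrow Z F)) where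
  continuous_const_smul g := (classifyingMap (StructuredArrow.map g.inv)).continuous

theorem cell_liftSimplex_mem_orbit {n : ℕ} (σ : Fin (n + 1) ⥤ C) (f f' : Z ⟶ F.obj (σ.obj 0))
    (t : stdSimplex ℝ (Fin (n + 1))) :
    cell (liftSimplex σ f) t ∈ MulAction.orbit (Aut Z) (cell (liftSimplex σ f') t) := by
  refine ⟨(Groupoid.isoEquivHom _ _).symm (f' ≫ Groupoid.inv f),
    (classifyingMap_map_cell_liftSimplex _ σ f' t).trans ?_⟩
  congr 2
  simp [Groupoid.isoEquivHom]

/-- The projection to `BC` from the classifying space of the fiber category of `F : C ⥤ G`. -/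
noncomputable abbrev fiberProj (Z : G) (F : C ⥤ G) :
    C(classifyingSpace (StructuredArrow Z F), classifyingSpace C) :=
  classifyingMap (StructuredArrow.proj Z F)

theorem fiberProj_smul (g : Aut Z) (x : classifyingSpace (StructuredArrow Z F)) :
    fiberProj Z F (g • x) = fiberProj Z F x := by
  rw [smul_def, ← ContinuousMap.comp_apply, ← classifyingMap_comp]
  rfl

/-- The inverse, with values in the orbit space, of the map induced by `fiberProj` on orbits: the
simplices of the fiber category over a given simplex of `C` form a single orbit. -/
noncomputable def orbitFamily (F : C ⥤ G) (hZ : ∀ X : G, Nonempty (Z ⟶ X)) : CellFamily C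
    (MulAction.orbitRel.Quotient (Aut Z) (classifyingSpace (StructuredArrow Z F))) where
  toFun σ := ⟨fun t => Quotient.mk _ (cell (liftSimplex σ (hZ _).some) t),
    continuous_quotient_mk'.comp (cell _).continuous⟩
  map f σ t := by
    refine Quotient.sound ?_
    rw [cell_map, precomp_liftSimplex]
    exact cell_liftSimplex_mem_orbit _ _ _ t

theorem orbitFamily_desc_fiberProj (F : C ⥤ G) (hZ : ∀ X : G, Nonempty (Z ⟶ X))
    (x : classifyingSpace (StructuredArrow Z F)) :
    (orbitFamily F hZ).desc (fiberProj Z F x) = Quotient.mk _ x := by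
  obtain ⟨n, σ, f, t, rfl⟩ := exists_cell_liftSimplex_eq x
  rw [classifyingMap_cell, CellFamily.desc_cell]
  exact Quotient.sound (cell_liftSimplex_mem_orbit σ _ f t)

theorem fiberProj_eq_iff (hZ : ∀ X : G, Nonempty (Z ⟶ X))
    {x y : classifyingSpace (StructuredArrow Z F)} :
    fiberProj Z F x = fiberProj Z F y ↔ x ∈ MulAction.orbit (Aut Z) y := by
  constructor
  · intro h
    have orbit_eq := congrArg (orbitFamily F hZ).desc h
    rw [orbitFamily_desc_fiberProj, orbitFamily_desc_fiberProj] at orbit_eq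
    exact Quotient.exact orbit_eq
  · rintro ⟨g, rfl⟩
    exact fiberProj_smul g y

theorem fiberProj_surjective (hZ : ∀ X : G, Nonempty (Z ⟶ X)) :
    Function.Surjective (fiberProj Z F) := fun x => by
  obtain ⟨n, σ, t, rfl⟩ := exists_cell_eq x
  exact ⟨cell (liftSimplex σ (hZ _).some) t, classifyingMap_cell _ _ _⟩

theorem isQuotientMap_fiberProj (hZ : ∀ X : G, Nonempty (Z ⟶ X)) :
    Topology.IsQuotientMap (fiberProj Z F) := by
  have continuous_lift : Continuous (Quotient.lift (s := MulAction.orbitRel (Aut Z) _)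
      (fiberProj Z F) fun x y hxy => (fiberProj_eq_iff hZ).2 hxy) :=
    (fiberProj Z F).continuous.quotient_lift _
  refine Topology.IsQuotientMap.comp (g := Quotient.lift _ _)
    (Topology.IsQuotientMap.of_inverse (f := (orbitFamily F hZ).desc)
      (ContinuousMap.continuous _) continuous_lift fun x => ?_) isQuotientMap_quotient_mk'
  obtain ⟨y, rfl⟩ := fiberProj_surjective (F := F) hZ x
  rw [orbitFamily_desc_fiberProj]
  rfl

/-- The sheet of the covering on which an object of the fiber category lies: its structure map, seen
as an endomorphism of `Z` through a choice of an arrow from `Z` to every object. -/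
noncomputable def sheet (hZ : ∀ X : G, Nonempty (Z ⟶ X)) (Y : StructuredArrow Z F) : Z ⟶ Z :=
  Y.hom ≫ Groupoid.inv (hZ (F.obj Y.right)).some

theorem sheet_map (hZ : ∀ X : G, Nonempty (Z ⟶ X)) (g : Z ⟶ Z) (Y : StructuredArrow Z F) :
    sheet hZ ((StructuredArrow.map g).obj Y) = g ≫ sheet hZ Y :=
  Category.assoc _ _ _

theorem isQuotientCoveringMap_fiberProj (hZ : ∀ X : G, Nonempty (Z ⟶ X)) :
    IsQuotientCoveringMap (fiberProj Z F) (Aut Z) where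
  toIsQuotientMap := isQuotientMap_fiberProj hZ
  apply_eq_iff_mem_orbit := fiberProj_eq_iff hZ
  disjoint x := by
    obtain ⟨X, c, hc, half_lt⟩ := exists_half_lt_occupation x
    let p (Y : StructuredArrow Z F) : Prop := sheet hZ Y = sheet hZ X
    refine ⟨{y | c / 2 < occupation p c y},
      (isOpen_lt continuous_const (continuous_occupation p c)).mem_nhds (half_lt p rfl),
      fun g => ?_⟩
    rintro ⟨_, ⟨y, hy, rfl⟩, hgy⟩
    by_contra g_ne_one
    have not_translate (Y : StructuredArrow Z F) (hY : p Y) :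
        ¬ p ((StructuredArrow.map g.inv).obj Y) := fun hgY => g_ne_one <| by
      have inv_eq_id : g.inv = 𝟙 Z := (cancel_mono (sheet hZ Y)).1 <| by
        rw [Category.id_comp, ← sheet_map]
        exact hgY.trans hY.symm
      exact inv_eq_one.1 (Iso.ext inv_eq_id)
    have sum_le : occupation p c y + occupation p c (g • y) ≤ c :=
      occupation_add_le (StructuredArrow.map g.inv) not_translate hc.le y
    simp only [Set.mem_ofPred_eq] at hy hgy
    linarith

end Fiber

/-! ### Homotopy fibers and pullbacks of coverings -/

section CoveringPullback

open unitInterval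

variable {X B E Y P : Type*} [TopologicalSpace X] [TopologicalSpace B] [TopologicalSpace E]
  [TopologicalSpace Y] [TopologicalSpace P]

/-- The paths in the homotopy fiber of `p` over `b`, run backwards from `b`. -/
def reversedPath (p : C(X, B)) (b : B) : C(I × HomotopyFiber p b, B) where
  toFun a := a.2.1.2 (σ a.1)
  continuous_toFun := by
    change Continuous fun a : I × {q : X × C(I, B) // q.2 0 = p q.1 ∧ q.2 1 = b} => a.2.1.2 (σ a.1)
    fun_prop

theorem reversedPath_zero (p : C(X, B)) (b : B) (a : HomotopyFiber p b) :
    reversedPath p b (0, a) = b :=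
  (congrArg a.1.2 symm_zero).trans a.2.2

/-- The lift to a covering `π : E → B` of the paths in the homotopy fiber of `p` over `π e₀` which
ends at `e₀`. -/
noncomputable def terminalLift (p : C(X, B)) {π : C(E, B)} (cov : IsCoveringMap π) (e₀ : E) :
    C(I × HomotopyFiber p (π e₀), E) :=
  (cov.liftHomotopy (reversedPath p (π e₀)) (ContinuousMap.const _ e₀)
    (reversedPath_zero p (π e₀))).comp ((ContinuousMap.mk σ continuous_symm).prodMap (.id _))

theorem map_terminalLift (p : C(X, B)) {π : C(E, B)} (cov : IsCoveringMap π) (e₀ : E) (s : I)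
    (a : HomotopyFiber p (π e₀)) : π (terminalLift p cov e₀ (s, a)) = a.1.2 s :=
  (congr_fun (cov.liftHomotopy_lifts _ _ (reversedPath_zero p (π e₀))) (σ s, a)).trans
    (congrArg a.1.2 (symm_symm s))

theorem terminalLift_one (p : C(X, B)) {π : C(E, B)} (cov : IsCoveringMap π) (e₀ : E)
    (a : HomotopyFiber p (π e₀)) : terminalLift p cov e₀ (1, a) = e₀ :=
  congr(cov.liftHomotopy _ _ (reversedPath_zero p (π e₀)) ($symm_one, a)).trans
    (cov.liftHomotopy_zero _ _ _ a)

theorem map_terminalLift_zero (p : C(X, B)) {π : C(E, B)} (cov : IsCoveringMap π) (e₀ : E)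
    (a : HomotopyFiber p (π e₀)) : p a.1.1 = π (terminalLift p cov e₀ (0, a)) := by
  rw [map_terminalLift, a.2.1]

theorem eq_terminalLift (p : C(X, B)) {π : C(E, B)} (cov : IsCoveringMap π) {e₀ : E}
    (a : HomotopyFiber p (π e₀)) (γ : C(I, E)) (γ_one : γ 1 = e₀) (map_γ : ∀ s, π (γ s) = a.1.2 s)
    (s : I) : γ s = terminalLift p cov e₀ (s, a) :=
  congr_fun (cov.eq_of_comp_eq (g₂ := fun s => terminalLift p cov e₀ (s, a)) γ.continuous
    (by fun_prop) (funext fun s => (map_γ s).trans (map_terminalLift p cov e₀ s a).symm) 1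
    (γ_one.trans (terminalLift_one p cov e₀ a).symm)) s

/-- The first half of `[0, 1]`, stretched to `[0, 1]` and followed by the constant `1`. -/
def firstRamp (s : I) : I :=
  ⟨min (2 * s) 1, le_min (by linarith [s.2.1]) zero_le_one, min_le_right _ _⟩

@[fun_prop]
theorem continuous_firstRamp : Continuous firstRamp := by unfold firstRamp; fun_prop

theorem firstRamp_zero : firstRamp 0 = 0 := Subtype.ext (by simp [firstRamp])

theorem firstRamp_one : firstRamp 1 = 1 := Subtype.ext (by simp [firstRamp])

theorem firstRamp_eq_one_or (s : I) : firstRamp s = 1 ∨ firstRamp (σ s) = 1 := by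
  rcases le_total (1 : ℝ) (2 * s) with h | h
  · exact Or.inl (Subtype.ext (min_eq_right h))
  · exact Or.inr (Subtype.ext (min_eq_right (by rw [coe_symm_eq]; linarith)))

/-- A deformation of paths `γ` ending at `e₀` to the paths along which a contraction `h` to `e₀`
moves their starting points. The parameter `s` of the deformation acts on `γ` in two halves, so that
the end point stays at `e₀` as soon as `h` fixes `e₀`. -/
def contractPath {e₀ : E} (h : (ContinuousMap.id E).Homotopy (ContinuousMap.const E e₀))
    (γ : C(I × P, E)) : C((I × P) × I, E) :=
  ⟨fun a => h (a.2 * firstRamp a.1.1, γ (a.2 * firstRamp (σ a.1.1), a.1.2)), by fun_prop⟩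

section ContractPath

variable {e₀ : E} (h : (ContinuousMap.id E).Homotopy (ContinuousMap.const E e₀)) (γ : C(I × P, E))

theorem contractPath_apply (s : I) (a : P) (u : I) : contractPath h γ ((s, a), u) =
    h (u * firstRamp s, γ (u * firstRamp (σ s), a)) := rfl

theorem contractPath_source (s : I) (a : P) : contractPath h γ ((s, a), 0) = γ (0, a) := by
  rw [contractPath_apply, zero_mul, zero_mul, h.apply_zero, ContinuousMap.id_apply]

theorem contractPath_target (h_fix : ∀ s, h (s, e₀) = e₀) {a : P} (γ_one : γ (1, a) = e₀) (s : I) :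
    contractPath h γ ((s, a), 1) = e₀ := by
  rw [contractPath_apply, one_mul, one_mul]
  rcases firstRamp_eq_one_or s with hs | hs
  · rw [hs, h.apply_one, ContinuousMap.const_apply]
  · rw [hs, γ_one, h_fix]

theorem contractPath_zero (a : P) (u : I) : contractPath h γ ((0, a), u) = γ (u, a) := by
  rw [contractPath_apply, firstRamp_zero, symm_zero, firstRamp_one, mul_zero, mul_one,
    h.apply_zero, ContinuousMap.id_apply]

theorem contractPath_one (a : P) (u : I) : contractPath h γ ((1, a), u) = h (u, γ (0, a)) := by
  rw [contractPath_apply, firstRamp_one, symm_one, firstRamp_zero, mul_zero, mul_one]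

end ContractPath

/-- The square formed by `p`, `π`, `π'` and `q` exhibits `Y`, as a set, as the pullback of the
covering `π : E → B` along `p : X → B`, and its projection `π'` is open. By `homeomorph` it is then
a pullback of topological spaces. -/
structure IsCoveringPullback (p : C(X, B)) (π : C(E, B)) (π' : C(Y, X)) (q : C(Y, E)) : Prop where
  comm (y : Y) : p (π' y) = π (q y)
  isCoveringMap : IsCoveringMap π
  isOpenMap : IsOpenMap π'
  injective : Function.Injective fun y => (π' y, q y)
  exists_of_eq {x : X} {e : E} : p x = π e → ∃ y, π' y = x ∧ q y = e

namespace IsCoveringPullback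

variable {p : C(X, B)} {π : C(E, B)} {π' : C(Y, X)} {q : C(Y, E)}
  (sq : IsCoveringPullback p π π' q)

include sq

theorem isOpenMap_pair :
    IsOpenMap fun y => (⟨(π' y, q y), sq.comm y⟩ : {a : X × E // p a.1 = π a.2}) := fun U hU => by
  rw [isOpen_iff_mem_nhds]
  rintro _ ⟨y, hy, rfl⟩
  obtain ⟨W, hW, hyW, injOn_W⟩ := sq.isCoveringMap.isLocalHomeomorph.isLocallyInjective (q y)
  have isOpen_sheet : IsOpen {a : {a : X × E // p a.1 = π a.2} |
      a.1.1 ∈ π' '' (U ∩ q ⁻¹' W) ∧ a.1.2 ∈ W} :=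
    ((sq.isOpenMap _ (hU.inter (hW.preimage q.continuous))).preimage (by fun_prop)).inter
      (hW.preimage (by fun_prop))
  refine Filter.mem_of_superset (isOpen_sheet.mem_nhds ⟨⟨y, ⟨hy, hyW⟩, rfl⟩, hyW⟩) ?_
  rintro ⟨⟨_, e⟩, h⟩ ⟨⟨u, ⟨hu, huW⟩, rfl⟩, he⟩
  exact ⟨u, hu, Subtype.ext (Prod.ext rfl (injOn_W huW he ((sq.comm u).symm.trans h)))⟩

/-- The homeomorphism from `Y` to the pullback of topological spaces. -/
noncomputable def homeomorph : Y ≃ₜ {a : X × E // p a.1 = π a.2} :=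
  (Equiv.ofBijective _ ⟨fun _ _ h => sq.injective (congrArg Subtype.val h), fun ⟨_, h⟩ =>
    let ⟨y, fst_eq, snd_eq⟩ := sq.exists_of_eq h
    ⟨y, Subtype.ext (Prod.ext fst_eq snd_eq)⟩⟩).toHomeomorphOfContinuousOpen
      (Continuous.subtype_mk (by fun_prop) _) sq.isOpenMap_pair

/-- The map from the homotopy fiber of `p` to `Y` that sends `(x, γ)` to the point given by `x` and
the starting point of the lift of `γ` which ends at `e₀`. -/
noncomputable def ofHomotopyFiber (e₀ : E) : C(HomotopyFiber p (π e₀), Y) :=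
  ⟨fun a => sq.homeomorph.symm ⟨(a.1.1, terminalLift p sq.isCoveringMap e₀ (0, a)),
    map_terminalLift_zero p sq.isCoveringMap e₀ a⟩,
    sq.homeomorph.symm.continuous.comp <|
      ((continuous_fst.comp continuous_subtype_val).prodMk (by fun_prop)).subtype_mk _⟩

theorem proj_ofHomotopyFiber (e₀ : E) (a : HomotopyFiber p (π e₀)) :
    π' (sq.ofHomotopyFiber e₀ a) = a.1.1 :=
  congrArg (fun z => z.1.1) (sq.homeomorph.apply_symm_apply _)

theorem map_ofHomotopyFiber (e₀ : E) (a : HomotopyFiber p (π e₀)) :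
    q (sq.ofHomotopyFiber e₀ a) = terminalLift p sq.isCoveringMap e₀ (0, a) :=
  congrArg (fun z => z.1.2) (sq.homeomorph.apply_symm_apply _)

variable {e₀ : E} (h : (ContinuousMap.id E).Homotopy (ContinuousMap.const E e₀))

/-- The null homotopy of `p ∘ π'` induced by a contraction of the total space of the covering. -/
def nullHomotopy : (p.comp π').Homotopy (ContinuousMap.const Y (π e₀)) where
  toFun a := π (h (a.1, q a.2))
  map_zero_left y := by
    rw [h.apply_zero]
    exact (sq.comm y).symm
  map_one_left y := by rw [h.apply_one, ContinuousMap.const_apply, ContinuousMap.const_apply]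

theorem ofHomotopyFiber_comp_toHomotopyFiber :
    (sq.ofHomotopyFiber e₀).comp (toHomotopyFiber π' p (π e₀) (sq.nullHomotopy h)) =
      ContinuousMap.id Y := by
  ext y
  let a := toHomotopyFiber π' p (π e₀) (sq.nullHomotopy h) y
  have lift_eq := eq_terminalLift p sq.isCoveringMap a (h.evalAt (q y)).toContinuousMap
    (h.apply_one _) (fun _ => rfl) 0
  refine sq.injective (Prod.ext (sq.proj_ofHomotopyFiber e₀ a) ?_)
  exact (sq.map_ofHomotopyFiber e₀ a).trans (lift_eq.symm.trans (h.apply_zero _))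

/-- The homotopy from the identity of the homotopy fiber which contracts the lift of its path. -/
noncomputable def fiberHomotopy (h_fix : ∀ s, h (s, e₀) = e₀) :
    (ContinuousMap.id (HomotopyFiber p (π e₀))).Homotopy
      ((toHomotopyFiber π' p (π e₀) (sq.nullHomotopy h)).comp (sq.ofHomotopyFiber e₀)) :=
  let γ := terminalLift p sq.isCoveringMap e₀
  let path := (π.comp (contractPath h γ)).curry
  { toFun a := ⟨(a.2.1.1, path a),
      (congrArg π (contractPath_source h γ a.1 a.2)).trans
        (map_terminalLift_zero p sq.isCoveringMap e₀ a.2).symm,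
      congrArg π (contractPath_target h γ h_fix (terminalLift_one p sq.isCoveringMap e₀ a.2) a.1)⟩
    continuous_toFun := Continuous.subtype_mk
      (((continuous_fst.comp continuous_subtype_val).comp continuous_snd).prodMk path.continuous) _
    map_zero_left a := Subtype.ext <| Prod.ext rfl <| ContinuousMap.ext fun u =>
      (congrArg π (contractPath_zero h γ a u)).trans (map_terminalLift p sq.isCoveringMap e₀ u a)
    map_one_left a := Subtype.ext <| Prod.ext (sq.proj_ofHomotopyFiber e₀ a).symm <|
      ContinuousMap.ext fun u => (congrArg π (contractPath_one h γ a u)).trans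
        (congrArg (fun e => π (h (u, e))) (sq.map_ofHomotopyFiber e₀ a).symm) }

theorem isHomotopyFiberSequence (h_fix : ∀ s, h (s, e₀) = e₀) :
    IsHomotopyFiberSequence π' p (π e₀) :=
  ⟨sq.nullHomotopy h, ⟨toHomotopyFiber π' p (π e₀) (sq.nullHomotopy h), sq.ofHomotopyFiber e₀,
    sq.ofHomotopyFiber_comp_toHomotopyFiber h ▸ .refl _, .symm ⟨sq.fiberHomotopy h h_fix⟩⟩, rfl⟩

end IsCoveringPullback

theorem IsHomotopyFiberSequence.comp_isHomotopyEquivalence {i : C(Y, X)} {p : C(X, B)} {b : B}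
    (h : IsHomotopyFiberSequence i p b) {j : C(P, Y)} (hj : IsHomotopyEquivalence j) :
    IsHomotopyFiberSequence (i.comp j) p b := by
  obtain ⟨H, e, he⟩ := h
  obtain ⟨e', rfl⟩ := hj
  exact ⟨(H.compContinuousMap e'.toFun).cast rfl rfl, e'.trans e,
    ContinuousMap.ext fun a => DFunLike.congr_fun he (e'.toFun a)⟩

end CoveringPullback

section FiberSequence

universe u

variable {C D G : Type u} [SmallCategory C] [SmallCategory D] [Groupoid.{u} G]

theorem classifyingMap_vertex (F : C ⥤ D) (X : C) :
    classifyingMap F (vertex X) = vertex (F.obj X) := by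
  rw [vertex_eq_cell X default, vertex_eq_cell (F.obj X) default, classifyingMap_cell]
  exact congrArg (cell · default) (ComposableArrows.ext₀ rfl)

theorem classifyingMap_const (Y : D) :
    classifyingMap ((Functor.const C).obj Y) = ContinuousMap.const _ (vertex Y) :=
  continuousMap_ext_cell fun n σ t => by
    rw [classifyingMap_cell, ContinuousMap.const_apply,
      vertex_eq_cell Y (stdSimplex.map (OrderHom.const (Fin (n + 1)) (0 : Fin 1)) t), cell_map]
    rfl

/-- The natural transformation from the constant functor at the initial object `𝟙 Z` of the category
of arrows out of `Z`. -/
def arrowFromId (Z : G) : (Functor.const (StructuredArrow Z (𝟭 G))).obj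
    (StructuredArrow.mk (T := 𝟭 G) (𝟙 Z)) ⟶ 𝟭 (StructuredArrow Z (𝟭 G)) where
  app X := StructuredArrow.homMk X.hom (Category.id_comp _)
  naturality X Y f := by
    ext
    exact (Category.id_comp _).trans (StructuredArrow.w f).symm

/-- The contraction, to the vertex `𝟙 Z`, of the classifying space of the category of arrows out of
`Z`. -/
noncomputable def arrowContraction (Z : G) :
    (ContinuousMap.id (classifyingSpace (StructuredArrow Z (𝟭 G)))).Homotopy
      (ContinuousMap.const _ (vertex (StructuredArrow.mk (T := 𝟭 G) (𝟙 Z)))) :=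
  ((natTransHomotopy (arrowFromId Z)).cast (classifyingMap_const _) classifyingMap_id).symm

theorem arrowContraction_vertex (Z : G) (s : unitInterval) :
    arrowContraction Z (s, vertex (StructuredArrow.mk (T := 𝟭 G) (𝟙 Z))) =
      vertex (StructuredArrow.mk (T := 𝟭 G) (𝟙 Z)) := by
  rw [arrowContraction, ContinuousMap.Homotopy.symm_apply]
  exact natTransHomotopy_vertex (arrowFromId Z) (StructuredArrow.mk (T := 𝟭 G) (𝟙 Z)) rfl rfl
    (unitInterval.symm s)

/-- The functor from the fiber category of `F` over `Z` to the category of arrows out of `Z`, which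
is the fiber category of the identity. -/
def fiberToArrow (Z : G) (F : C ⥤ G) : StructuredArrow Z F ⥤ StructuredArrow Z (𝟭 G) :=
  fiberLift (StructuredArrow.proj Z F ⋙ F) (fun X => X.hom) fun h => StructuredArrow.w h

theorem classifyingMap_fiberToArrow_smul {Z : G} {F : C ⥤ G} (g : Aut Z)
    (x : classifyingSpace (StructuredArrow Z F)) :
    classifyingMap (fiberToArrow Z F) (g • x) = g • classifyingMap (fiberToArrow Z F) x := by
  rw [smul_def, smul_def, ← ContinuousMap.comp_apply, ← ContinuousMap.comp_apply,
    ← classifyingMap_comp, ← classifyingMap_comp]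
  rfl

theorem classifyingMap_fiberProj (Z : G) (F : C ⥤ G) (x : classifyingSpace (StructuredArrow Z F)) :
    classifyingMap F (fiberProj Z F x) =
      fiberProj Z (𝟭 G) (classifyingMap (fiberToArrow Z F) x) := by
  rw [← ContinuousMap.comp_apply, ← ContinuousMap.comp_apply, ← classifyingMap_comp,
    ← classifyingMap_comp]
  rfl

theorem isCoveringPullback_fiberProj (F : C ⥤ G) {Z : G} (hZ : ∀ X : G, Nonempty (Z ⟶ X)) :
    IsCoveringPullback (classifyingMap F) (fiberProj Z (𝟭 G)) (fiberProj Z F)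
      (classifyingMap (fiberToArrow Z F)) where
  comm := classifyingMap_fiberProj Z F
  isCoveringMap := (isQuotientCoveringMap_fiberProj hZ).isCoveringMap
  isOpenMap := (isQuotientCoveringMap_fiberProj hZ).isCoveringMap.isOpenMap
  injective x y hxy := by
    obtain ⟨proj_eq, arrow_eq⟩ := Prod.mk.inj hxy
    obtain ⟨g, rfl⟩ := (fiberProj_eq_iff hZ).1 proj_eq
    have := (isQuotientCoveringMap_fiberProj (F := 𝟭 G) hZ).isCancelSMul
    obtain rfl : g = 1 := IsCancelSMul.right_cancel g 1 (classifyingMap (fiberToArrow Z F) y) <| by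
      rw [one_smul, ← classifyingMap_fiberToArrow_smul]
      exact arrow_eq
    exact one_smul _ y
  exists_of_eq {x e} h := by
    obtain ⟨y, rfl⟩ := fiberProj_surjective (F := F) hZ x
    obtain ⟨g, hg⟩ := (fiberProj_eq_iff hZ).1 (h.symm.trans (classifyingMap_fiberProj Z F y))
    exact ⟨g • y, fiberProj_smul g y, (classifyingMap_fiberToArrow_smul g y).trans hg⟩

theorem isHomotopyFiberSequence_fiberProj (F : C ⥤ G) {Z : G} (hZ : ∀ X : G, Nonempty (Z ⟶ X)) :
    IsHomotopyFiberSequence (fiberProj Z F) (classifyingMap F) (vertex Z) := by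
  have fiberSequence := (isCoveringPullback_fiberProj F hZ).isHomotopyFiberSequence
    (arrowContraction Z) (arrowContraction_vertex Z)
  rwa [classifyingMap_vertex] at fiberSequence

end FiberSequence

/-! ### Representations of matroids and their first homology -/

section LinearIndependence

variable {ι ι' R V W : Type*} [Ring R] [AddCommGroup V] [Module R V] [AddCommGroup W] [Module R W]

theorem linearIndepOn_comp_iff_injOn [Nontrivial R] (v : ι → V) (φ : ι' → ι) (s : Set ι') :
    LinearIndepOn R (v ∘ φ) s ↔ Set.InjOn φ s ∧ LinearIndepOn R v (φ '' s) :=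
  ⟨fun h => ⟨fun _ hx _ hy hxy => h.injOn hx hy (congrArg v hxy), h.image_of_comp _ _⟩,
    fun h => h.2.comp_of_image h.1⟩

theorem injective_of_linearIndepOn_comp {f : V →ₗ[R] W} {v : ι → V} {s : Set ι}
    (span_eq_top : Submodule.span R (v '' s) = ⊤) (h : LinearIndepOn R (f ∘ v) s) :
    Function.Injective f := by
  have surjective : Function.Surjective (Finsupp.linearCombination R fun i : s => v i) := by
    rwa [← LinearMap.range_eq_top, Finsupp.range_linearCombination, ← Set.image_eq_range]
  refine Function.Injective.of_comp_right ?_ surjective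
  rw [← LinearMap.coe_comp, ← Finsupp.linearCombination_linear_comp]
  exact h

end LinearIndependence

section Representations

variable {E E' K V : Type} [Field K] [AddCommGroup V] [Module K V]

theorem IsRepresentation.linearEquiv_comp {W : Type} [AddCommGroup W] [Module K W] {M : Matroid E}
    {ρ : E → V} (hρ : IsRepresentation K M ρ) (e : V ≃ₗ[K] W) : IsRepresentation K M (e ∘ ρ) := by
  refine ⟨fun I => (hρ.1 I).trans
    (LinearMap.linearIndepOn_iff_of_injOn e.toLinearMap e.injective.injOn).symm, ?_⟩
  rw [Set.range_comp, ← LinearEquiv.coe_coe, ← Submodule.map_span, hρ.2, Submodule.map_top,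
    LinearEquiv.range]

theorem IsRepresentable.of_indep_iff {M : Matroid E} {ρ : E → V}
    (h : ∀ I : Set E, M.Indep I ↔ LinearIndepOn K ρ I) : IsRepresentable K M := by
  let ρ' (e : E) : Submodule.span K (Set.range ρ) := ⟨ρ e, Submodule.subset_span ⟨e, rfl⟩⟩
  refine ⟨Submodule.span K (Set.range ρ), inferInstance, inferInstance, ρ', fun I => ?_, ?_⟩
  · rw [h]
    exact LinearMap.linearIndepOn_iff_of_injOn (Submodule.subtype _) (v := ρ')
      (Submodule.subtype_injective _).injOn
  · rw [← (Submodule.map_injective_of_injective (Submodule.subtype_injective _)).eq_iff,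
      Submodule.map_span, ← Set.range_comp, Submodule.map_top, Submodule.range_subtype]
    rfl

theorem IsRegular.of_indep_iff_image {M : Matroid E} (hM : IsRegular M) {M' : Matroid E'}
    (φ : E' → E) (h : ∀ I, M'.Indep I ↔ Set.InjOn φ I ∧ M.Indep (φ '' I)) : IsRegular M' := by
  intro K _
  obtain ⟨V, _, _, ρ, hρ, -⟩ := hM K
  refine IsRepresentable.of_indep_iff (ρ := ρ ∘ φ) fun I => ?_
  rw [h, hρ, linearIndepOn_comp_iff_injOn]

theorem span_image_of_isBase_linearMatroid [Finite E] {ρ : E → V} {B : Set E}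
    (hB : (linearMatroid K ρ).IsBase B) :
    Submodule.span K (ρ '' B) = Submodule.span K (Set.range ρ) := by
  refine le_antisymm (Submodule.span_mono (Set.image_subset_range _ _)) (Submodule.span_le.2 ?_)
  rintro _ ⟨e, rfl⟩
  by_contra notMem_span
  have notMem_base : e ∉ B := fun he => notMem_span (Submodule.subset_span ⟨e, he, rfl⟩)
  have indep_insert : (linearMatroid K ρ).Indep (insert e B) :=
    LinearIndepOn.insert hB.indep notMem_span
  exact notMem_base
    (hB.eq_of_subset_indep indep_insert (Set.subset_insert _ _) ▸ Set.mem_insert e B)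

theorem eRank_linearMatroid [Finite E] (ρ : E → V) :
    (linearMatroid K ρ).eRank = Module.finrank K (Submodule.span K (Set.range ρ)) := by
  obtain ⟨B, hB⟩ := (linearMatroid K ρ).exists_isBase
  have linearIndepOn_base : LinearIndepOn K ρ B := hB.indep
  have := Fintype.ofFinite B
  rw [← span_image_of_isBase_linearMatroid hB, Set.image_eq_range,
    finrank_span_eq_card linearIndepOn_base, ← hB.encard_eq_eRank,
    ← (Set.toFinite B).cast_ncard_eq, ← Nat.card_coe_set_eq, Nat.card_eq_fintype_card]

theorem eRank_linearMatroid_eq_iff [Finite E] [FiniteDimensional K V] {r : ℕ}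
    (hV : Module.finrank K V = r) (ρ : E → V) :
    (linearMatroid K ρ).eRank = r ↔ Submodule.span K (Set.range ρ) = ⊤ := by
  rw [eRank_linearMatroid, Nat.cast_inj, ← hV]
  exact ⟨Submodule.eq_top_of_finrank_eq, fun h => by rw [h, finrank_top]⟩

end Representations

section HomologyOfRepresentation

variable {E V : Type} [Finite E] {M : Matroid E} [AddCommGroup V] [Module (ZMod 2) V]

theorem H1F2.lift_bijective (hE : M.E = Set.univ) {ρ : E → V}
    (hρ : IsRepresentation (ZMod 2) M ρ) :
    Function.Bijective (H1F2.lift M ρ fun _ hC => sum_circuit_representation hρ.1 hC) := by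
  constructor
  · obtain ⟨B, hB⟩ := M.exists_isBase
    refine injective_of_linearIndepOn_comp (H1F2.span_base hE hB) ?_
    rw [show H1F2.lift M ρ _ ∘ H1F2.of M = ρ from funext (H1F2.lift_of M ρ _)]
    exact (hρ.1 B).1 hB.indep
  · refine LinearMap.range_eq_top.1 (top_le_iff.1 (hρ.2.ge.trans (Submodule.span_le.2 ?_)))
    rintro _ ⟨e, rfl⟩
    exact ⟨H1F2.of M e, H1F2.lift_of _ _ _ _⟩

/-- The isomorphism from `H₁(M; 𝔽₂)` to the target of a representation of `M` over `𝔽₂`. -/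
noncomputable def homologyEquiv (hE : M.E = Set.univ) {ρ : E → V}
    (hρ : IsRepresentation (ZMod 2) M ρ) : H1F2 M ≃ₗ[ZMod 2] V :=
  LinearEquiv.ofBijective _ (H1F2.lift_bijective hE hρ)

theorem homologyEquiv_of (hE : M.E = Set.univ) {ρ : E → V} (hρ : IsRepresentation (ZMod 2) M ρ)
    (e : E) : homologyEquiv hE hρ (H1F2.of M e) = ρ e :=
  H1F2.lift_of M ρ (fun _ hC => sum_circuit_representation hρ.1 hC) e

theorem H1F2.isRepresentation_of (hE : M.E = Set.univ) (hM : IsRepresentable (ZMod 2) M) :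
    IsRepresentation (ZMod 2) M (H1F2.of M) := by
  refine ⟨fun I => ?_, H1F2.span_of M⟩
  obtain ⟨V, _, _, ρ, hρ⟩ := hM
  rw [hρ.1, ← funext (homologyEquiv_of hE hρ)]
  exact LinearMap.linearIndepOn_iff_of_injOn (homologyEquiv hE hρ).toLinearMap
    (homologyEquiv hE hρ).injective.injOn

end HomologyOfRepresentation

/-! ### The fiber category and the poset of sets of vectors -/

namespace FiberCategory

variable {r : ℕ} {Z : GL2 r}

/-- A choice of coordinates on `Z`. -/
noncomputable def coord (Z : GL2 r) : Z.V ≃ₗ[ZMod 2] (Fin r → ZMod 2) :=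
  Z.nonempty_equiv.some

/-- The structure isomorphism `Z ≃ H₁(M; 𝔽₂)` of an object of the fiber category. -/
noncomputable def iso (X : FiberCategory r Z) : Z.V ≃ₗ[ZMod 2] H1F2 X.right.M :=
  GL2.Hom.toEquiv X.hom

/-- The vector configuration in `𝔽₂ʳ` of an object of the fiber category: the classes in
`H₁(M; 𝔽₂)` of the elements of `M`, moved to `Z` by the structure isomorphism and expressed in
coordinates. -/
noncomputable def vec (X : FiberCategory r Z) (e : X.right.E) : Fin r → ZMod 2 :=
  coord Z ((iso X).symm (H1F2.of X.right.M e))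

theorem isRepresentation_vec (X : FiberCategory r Z) :
    IsRepresentation (ZMod 2) X.right.M (vec X) :=
  (H1F2.isRepresentation_of X.right.ground (X.right.regular (ZMod 2))).linearEquiv_comp
    ((iso X).symm.trans (coord Z))

theorem map_iso {X Y : FiberCategory r Z} (f : X ⟶ Y) (z : Z.V) :
    H1F2.map f.right (iso X z) = iso Y z :=
  congrArg (fun g : GL2.Hom Z _ => g.toEquiv z) (StructuredArrow.w f)

theorem vec_map {X Y : FiberCategory r Z} (f : X ⟶ Y) (e : X.right.E) :
    vec Y (f.right.toFun e) = vec X e := by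
  refine congrArg (coord Z) ((iso Y).symm_apply_eq.2 ?_)
  rw [← map_iso f, LinearEquiv.apply_symm_apply, H1F2.map_of]

theorem hom_ext {X Y : FiberCategory r Z} {f g : X ⟶ Y} (h : f.right.toFun = g.right.toFun) :
    f = g :=
  StructuredArrow.hom_ext _ _ (RegularMatroid.Hom.ext h)

/-- The morphism of matroids given by an injection compatible with the vector configurations. -/
def matroidHom {X Y : FiberCategory r Z} (φ : X.right.E → Y.right.E) (hφ : Function.Injective φ)
    (hvec : ∀ e, vec Y (φ e) = vec X e) : X.right ⟶ Y.right :=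
  (⟨φ, hφ, fun I => by
    rw [(isRepresentation_vec X).1, (isRepresentation_vec Y).1, ← linearIndepOn_comp_iff hφ,
      show vec Y ∘ φ = vec X from funext hvec]⟩ : RegularMatroid.Hom X.right Y.right)

theorem map_matroidHom {X Y : FiberCategory r Z} (φ : X.right.E → Y.right.E)
    (hφ : Function.Injective φ) (hvec : ∀ e, vec Y (φ e) = vec X e) (z : Z.V) :
    H1F2.map (matroidHom φ hφ hvec) (iso X z) = iso Y z := by
  have map_eq : H1F2.map (matroidHom φ hφ hvec) = ((iso X).symm.trans (iso Y)).toLinearMap := by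
    refine LinearMap.ext_on_range (H1F2.span_of X.right.M) fun e => ?_
    rw [H1F2.map_of]
    exact ((iso Y).symm_apply_eq).1 ((coord Z).injective (hvec e))
  simp [map_eq]

/-- The morphism of the fiber category given by an injection compatible with the vector
configurations. -/
noncomputable def homMk {X Y : FiberCategory r Z} (φ : X.right.E → Y.right.E)
    (hφ : Function.Injective φ) (hvec : ∀ e, vec Y (φ e) = vec X e) : X ⟶ Y :=
  StructuredArrow.homMk (matroidHom φ hφ hvec)
    (GL2.Hom.ext (LinearEquiv.ext (map_matroidHom φ hφ hvec)))

/-- The object of the fiber category given by a representation in `𝔽₂ʳ`. -/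
noncomputable def mk (Z : GL2 r) (A : RegularMatroid r) (ρ : A.E → Fin r → ZMod 2)
    (hρ : IsRepresentation (ZMod 2) A.M ρ) : FiberCategory r Z :=
  StructuredArrow.mk (Y := A) (⟨(coord Z).trans (homologyEquiv A.ground hρ).symm⟩ :
    GL2.Hom Z ((homologyFunctor r).obj A))

theorem vec_mk (A : RegularMatroid r) (ρ : A.E → Fin r → ZMod 2)
    (hρ : IsRepresentation (ZMod 2) A.M ρ) (e : A.E) : vec (mk Z A ρ hρ) e = ρ e :=
  ((coord Z).apply_symm_apply _).trans (homologyEquiv_of A.ground hρ e)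

/-- The set of nonzero vectors of the configuration of an object of the fiber category. -/
def support (X : FiberCategory r Z) : Set (Fin r → ZMod 2) := Set.range (vec X) \ {0}

theorem span_support (X : FiberCategory r Z) : Submodule.span (ZMod 2) (support X) = ⊤ := by
  rw [support, Submodule.span_sdiff_singleton_zero, (isRepresentation_vec X).2]

theorem support_mono {X Y : FiberCategory r Z} (f : X ⟶ Y) : support X ⊆ support Y := by
  rintro _ ⟨⟨e, rfl⟩, h⟩
  exact ⟨⟨f.right.toFun e, vec_map f e⟩, h⟩

theorem isRegular_linearMatroid (X : FiberCategory r Z) {E : Type} (ρ : E → Fin r → ZMod 2)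
    [Finite E] (h : ∀ e, ρ e ∈ Set.range (vec X)) : IsRegular (linearMatroid (ZMod 2) ρ) := by
  choose φ hφ using h
  obtain rfl : vec X ∘ φ = ρ := funext hφ
  refine X.right.regular.of_indep_iff_image φ fun I => ?_
  rw [linearMatroid_indep, linearIndepOn_comp_iff_injOn, (isRepresentation_vec X).1]

/-- The matroid of an object of the fiber category with a parallel copy of each of its distinct
nonzero vectors added. It receives the original matroid and the matroid of the nonzero vectors. -/
noncomputable def thicken (X : FiberCategory r Z) : RegularMatroid r where
  E := X.right.E ⊕ support X
  finite := inferInstance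
  M := linearMatroid (ZMod 2) (Sum.elim (vec X) Subtype.val)
  ground := rfl
  rank := (eRank_linearMatroid_eq_iff (Module.finrank_fin_fun _) _).2 (by
    rw [Set.Sum.elim_range, Submodule.span_union, (isRepresentation_vec X).2, top_sup_eq])
  regular := isRegular_linearMatroid X _ (by
    rintro (e | s)
    · exact ⟨e, rfl⟩
    · exact s.2.1)

/-- The thickened matroid as an object of the fiber category. -/
noncomputable def thickenObj (X : FiberCategory r Z) : FiberCategory r Z :=
  mk Z (thicken X) (Sum.elim (vec X) Subtype.val) ⟨fun _ => Iff.rfl,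
    (eRank_linearMatroid_eq_iff (Module.finrank_fin_fun _) _).1 (thicken X).rank⟩

theorem vec_thickenObj (X : FiberCategory r Z) (e : X.right.E ⊕ support X) :
    vec (thickenObj X) e = Sum.elim (vec X) Subtype.val e :=
  vec_mk _ _ _ _

/-- Thickening as an endofunctor of the fiber category. -/
noncomputable def thickenFunctor (Z : GL2 r) : FiberCategory r Z ⥤ FiberCategory r Z where
  obj := thickenObj
  map {X Y} f := homMk (X := thickenObj X) (Y := thickenObj Y)
    (Sum.map f.right.toFun (Set.inclusion (support_mono f)))
    (f.right.injective.sumMap (Set.inclusion_injective _)) (by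
      intro e
      refine (vec_thickenObj Y _).trans (Eq.trans ?_ (vec_thickenObj X e).symm)
      rcases e with e | s
      · exact vec_map f e
      · rfl)
  map_id X := hom_ext (by
    funext e
    rcases e with e | s <;> rfl)
  map_comp f g := hom_ext (by
    funext e
    rcases e with e | s <;> rfl)

/-- The inclusion of a matroid in its thickening. -/
noncomputable def toThicken (Z : GL2 r) : 𝟭 (FiberCategory r Z) ⟶ thickenFunctor Z where
  app X := homMk (X := X) (Y := thickenObj X) Sum.inl Sum.inl_injective
    fun e => vec_thickenObj X (Sum.inl e)
  naturality _ _ _ := hom_ext rfl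

/-- The functor sending an object of the fiber category to its set of nonzero vectors. -/
noncomputable def supportFunctor (Z : GL2 r) : FiberCategory r Z ⥤ IR r where
  obj X :=
    { carrier := support X
      zero_notMem := fun h => h.2 rfl
      rank := (eRank_linearMatroid_eq_iff (Module.finrank_fin_fun _) _).2 (by
        rw [Subtype.range_coe, span_support])
      regular := isRegular_linearMatroid X _ fun s => s.2.1 }
  map f := homOfLE (support_mono f)

theorem isRepresentation_toRegularMatroid (S : IR r) :
    IsRepresentation (ZMod 2) S.toRegularMatroid.M (Subtype.val : S.carrier → Fin r → ZMod 2) :=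
  ⟨fun _ => Iff.rfl, (eRank_linearMatroid_eq_iff (Module.finrank_fin_fun _) _).1 S.rank⟩

/-- The object of the fiber category given by a set of vectors. -/
noncomputable def ofIRObj (Z : GL2 r) (S : IR r) : FiberCategory r Z :=
  mk Z S.toRegularMatroid Subtype.val (isRepresentation_toRegularMatroid S)

theorem vec_ofIRObj (S : IR r) (s : S.carrier) : vec (ofIRObj Z S) s = s.val :=
  vec_mk _ _ _ _

/-- The functor sending a set of vectors to the corresponding object of the fiber category; it
lifts `IR.inclusionFunctor`. -/
noncomputable def ofIR (Z : GL2 r) : IR r ⥤ FiberCategory r Z where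
  obj := ofIRObj Z
  map {S T} h := homMk (X := ofIRObj Z S) (Y := ofIRObj Z T)
    (Set.inclusion (show S.carrier ⊆ T.carrier from (leOfHom h : S ≤ T)))
    (Set.inclusion_injective _)
    fun s => (vec_ofIRObj T _).trans (vec_ofIRObj S s).symm
  map_id _ := hom_ext rfl
  map_comp _ _ := hom_ext rfl

theorem ofIR_proj (Z : GL2 r) :
    ofIR Z ⋙ StructuredArrow.proj Z (homologyFunctor r) = IR.inclusionFunctor r :=
  rfl

/-- The inclusion of the set of nonzero vectors in the thickening. -/
noncomputable def supportToThicken (Z : GL2 r) : supportFunctor Z ⋙ ofIR Z ⟶ thickenFunctor Z where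
  app X := homMk (X := ofIRObj Z ((supportFunctor Z).obj X)) (Y := thickenObj X)
    Sum.inr Sum.inr_injective
    fun s => (vec_thickenObj X (Sum.inr s)).trans
      (vec_ofIRObj ((supportFunctor Z).obj X) s).symm
  naturality _ _ _ := hom_ext rfl

theorem support_ofIRObj_subset (S : IR r) : support (ofIRObj Z S) ⊆ S.carrier := by
  rintro _ ⟨⟨s, rfl⟩, -⟩
  exact (vec_ofIRObj S s).symm ▸ s.2

/-- The set of nonzero vectors of the object given by `S` is contained in `S`. -/
noncomputable def supportOfIR (Z : GL2 r) : ofIR Z ⋙ supportFunctor Z ⟶ 𝟭 (IR r) where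
  app S := homOfLE (support_ofIRObj_subset S)

theorem isHomotopyEquivalence_ofIR (Z : GL2 r) :
    IsHomotopyEquivalence (classifyingMap (ofIR Z)) := by
  refine ⟨⟨classifyingMap (ofIR Z), classifyingMap (supportFunctor Z), ?_, ?_⟩, rfl⟩
  · rw [← classifyingMap_comp, ← classifyingMap_id]
    exact homotopic_of_natTrans (supportOfIR Z)
  · rw [← classifyingMap_comp, ← classifyingMap_id]
    exact (homotopic_of_natTrans (supportToThicken Z)).trans
      (homotopic_of_natTrans (toThicken Z)).symm

end FiberCategory

theorem GL2.nonempty_hom {r : ℕ} (Z X : GL2 r) : Nonempty (Z ⟶ X) :=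
  ⟨(⟨Z.nonempty_equiv.some.trans X.nonempty_equiv.some.symm⟩ : GL2.Hom Z X)⟩

end RegMatroid

theorem mainTheorem11 (r : ℕ) (hr : 1 ≤ r) (Z : GL2 r) :
    Nonempty (ContinuousMap.HomotopyEquiv
      (classifyingSpace (IR r)) (classifyingSpace (FiberCategory r Z))) ∧
    IsHomotopyFiberSequence
      (classifyingMap (IR.inclusionFunctor r))
      (classifyingMap (homologyFunctor r))
      (vertex Z) := by
  obtain ⟨e, he⟩ := FiberCategory.isHomotopyEquivalence_ofIR Z
  refine ⟨⟨e⟩, ?_⟩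
  have fiberSequence := (isHomotopyFiberSequence_fiberProj (homologyFunctor r)
    (GL2.nonempty_hom Z)).comp_isHomotopyEquivalence ⟨e, he⟩
  rwa [← classifyingMap_comp, FiberCategory.ofIR_proj] at fiberSequence
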